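/- Let $l>2$ be a prime, let $q$ be a prime power with $q\equiv 1 \pmod l$, let $E/\mathbb{Q}_l$ be a finite extension with ring of integers $\mathcal{O}$ and residue field $\mathbb{F}$, and let $\bar E$ be an algebraic closure of $E$. Let $\mathcal{X}_{\mathrm{St}}$ be the Zariski closure, with its reduced scheme structure, in $GL_{2,\mathcal{O}}\times GL_{2,\mathcal{O}}$ of the set of pairs $(\Phi,\Sigma)\in GL_2(\bar E)\times GL_2(\bar E)$ such that $\Phi\Sigma\Phi^{-1}=\Sigma^q$ and $\Sigma$ is regular unipotent, and let $\mathcal{X}\subset\mathcal{X}_{\mathrm{St}}$ be the closed subscheme on which $\operatorname{tr}(\Phi)=1+q$. For a matrix $A$ write $\chi_A(x)$ for its characteristic polynomial. Then: 1. $\mathcal{X}\subset GL_{2,\mathcal{O}}\times GL_{2,\mathcal{O}}$ is the closed subscheme of pairs $(\Phi,\Sigma)$ cut out by $$\Phi\Sigma\Phi^{-1}=\Sigma^q,\qquad \chi_\Phi(x)=(x-1)(x-q),\qquad \chi_\Sigma(x)=(x-1)^2,\qquad \operatorname{tr}(\Phi(\Sigma-I))=0.$$ 2. $\mathcal{X}_{\mathrm{St}}\subset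 GL_{2,\mathcal{O}}\times GL_{2,\mathcal{O}}$ is the closed subscheme cut out by $$\Phi\Sigma\Phi^{-1}=\Sigma^q,\qquad q\operatorname{tr}(\Phi)^2=(1+q)^2\det(\Phi),\qquad \chi_\Sigma(x)=(x-1)^2,\qquad \operatorname{tr}(\Phi(\Sigma-I))=0.$$ 3. The special fibre $\mathcal{X}_{\mathbb{F}}=\mathcal{X}\times_{\mathcal{O}}\mathbb{F}$ is reduced, and $(\Phi,\Sigma)\mapsto(M,N)=(\Phi-I,\Sigma-I)$ defines a closed immersion of $\mathcal{X}_{\mathbb{F}}$ into $\mathfrak{sl}_{2,\mathbb{F}}\times\mathfrak{sl}_{2,\mathbb{F}}$ whose image is the closed subscheme whose ideal is generated by $\det(M)$, $\det(N)$, the entries of $MN-NM$, and $\operatorname{tr}(MN)$. -/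

import Mathlib

/-!
Closed subschemes of an affine scheme `Spec A` are represented by their ideals in `A`, and
closed immersions into `Spec A` by surjective ring homomorphisms out of `A`.
-/

noncomputable section

namespace SteinbergModuli

/-- The polynomial ring in the entries of two generic `n × n` matrices. -/
abbrev PairPoly (n : ℕ) (R : Type*) [CommRing R] : Type _ :=
  MvPolynomial ((Fin n × Fin n) ⊕ (Fin n × Fin n)) R

/-- The first generic matrix. -/
def genericFst (n : ℕ) (R : Type*) [CommRing R] : Matrix (Fin n) (Fin n) (PairPoly n R) :=
  Matrix.of fun i j => MvPolynomial.X (Sum.inl (i, j))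

/-- The second generic matrix. -/
def genericSnd (n : ℕ) (R : Type*) [CommRing R] : Matrix (Fin n) (Fin n) (PairPoly n R) :=
  Matrix.of fun i j => MvPolynomial.X (Sum.inr (i, j))

/-- The coordinate ring of `GL_n × GL_n` over `R`. -/
abbrev CoordRing (n : ℕ) (R : Type*) [CommRing R] : Type _ :=
  Localization.Away ((genericFst n R).det * (genericSnd n R).det)

theorem isUnit_algebraMap_det_mul_det (n : ℕ) (R : Type*) [CommRing R] :
    IsUnit (algebraMap (PairPoly n R) (CoordRing n R) (genericFst n R).det *
      algebraMap (PairPoly n R) (CoordRing n R) (genericSnd n R).det) := by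
  rw [← map_mul]
  exact IsLocalization.Away.algebraMap_isUnit _

/-- The first component `Φ` of the universal point `(Φ, Σ)` of `GL_n × GL_n`. -/
def univPhi (n : ℕ) (R : Type*) [CommRing R] :
    Matrix.GeneralLinearGroup (Fin n) (CoordRing n R) :=
  Matrix.GeneralLinearGroup.mk''
    ((genericFst n R).map (algebraMap (PairPoly n R) (CoordRing n R)))
    (by
      have h := isUnit_of_mul_isUnit_left (isUnit_algebraMap_det_mul_det n R)
      rwa [RingHom.map_det] at h)

/-- The second component `Σ` of the universal point `(Φ, Σ)` of `GL_n × GL_n`. -/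
def univSigma (n : ℕ) (R : Type*) [CommRing R] :
    Matrix.GeneralLinearGroup (Fin n) (CoordRing n R) :=
  Matrix.GeneralLinearGroup.mk''
    ((genericSnd n R).map (algebraMap (PairPoly n R) (CoordRing n R)))
    (by
      have h := isUnit_of_mul_isUnit_right (isUnit_algebraMap_det_mul_det n R)
      rwa [RingHom.map_det] at h)

/-- A matrix over a field is regular unipotent if it is unipotent and regular, i.e. its minimal
polynomial is its characteristic polynomial. -/
def IsRegularUnipotent {n : ℕ} {K : Type*} [Field K] (A : Matrix (Fin n) (Fin n) K) : Prop :=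
  IsNilpotent (A - 1) ∧ minpoly K A = A.charpoly

/-- The points of the scheme `GL_n × GL_n` over `O` underlying the geometric points
`(Φ, Σ)`, with values in the algebraic closure of `E`, such that `Φ Σ Φ⁻¹ = Σ ^ q` and `Σ` is
regular unipotent. A geometric point is an `O`-algebra homomorphism `x` out of the coordinate
ring, and `Φ`, `Σ` are the images under `x` of the universal matrices. -/
def steinbergPoints (n q : ℕ) (O E : Type*) [CommRing O] [Field E] [Algebra O E] :
    Set (PrimeSpectrum (CoordRing n O)) :=
  {P | ∃ x : CoordRing n O →ₐ[O] AlgebraicClosure E,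
    let Φ := Matrix.GeneralLinearGroup.map (x : CoordRing n O →+* AlgebraicClosure E)
      (univPhi n O)
    let S := Matrix.GeneralLinearGroup.map (x : CoordRing n O →+* AlgebraicClosure E)
      (univSigma n O)
    Φ * S * Φ⁻¹ = S ^ q ∧
      IsRegularUnipotent (S : Matrix (Fin n) (Fin n) (AlgebraicClosure E)) ∧
      P.asIdeal = RingHom.ker x}

/-- The ideal of the Steinberg component `X_St`: the Zariski closure in `GL_n × GL_n` over `O`
of the points above, with its reduced structure. -/
def steinbergIdeal (n q : ℕ) (O E : Type*) [CommRing O] [Field E] [Algebra O E] :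
    Ideal (CoordRing n O) :=
  PrimeSpectrum.vanishingIdeal (closure (steinbergPoints n q O E))

/-- The ideal of the closed subscheme `X` of `X_St` on which
`tr Φ = 1 + q + ⋯ + q ^ (n - 1)`. -/
def steinbergTraceIdeal (n q : ℕ) (O E : Type*) [CommRing O] [Field E] [Algebra O E] :
    Ideal (CoordRing n O) :=
  steinbergIdeal n q O E ⊔
    Ideal.span {Matrix.trace (univPhi n O : Matrix (Fin n) (Fin n) (CoordRing n O)) -
      ∑ i ∈ Finset.range n, (q : CoordRing n O) ^ i}

/-- The ideal expressing the equation `A = B` between matrices. -/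
def matrixEqIdeal {n : ℕ} {A : Type*} [CommRing A] (M N : Matrix (Fin n) (Fin n) A) : Ideal A :=
  Ideal.span (Set.range fun ij : Fin n × Fin n => M ij.1 ij.2 - N ij.1 ij.2)

/-- The ideal expressing the equation `f = g` between polynomials, coefficient by coefficient. -/
def polyEqIdeal {A : Type*} [CommRing A] (f g : Polynomial A) : Ideal A :=
  Ideal.span (Set.range fun k : ℕ => f.coeff k - g.coeff k)

/-- The ideal of the equation `Φ Σ Φ⁻¹ = Σ ^ q`. -/
def conjIdeal (n q : ℕ) (O : Type*) [CommRing O] : Ideal (CoordRing n O) :=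
  matrixEqIdeal
    ((univPhi n O * univSigma n O * (univPhi n O)⁻¹ :
      Matrix.GeneralLinearGroup (Fin n) (CoordRing n O)) : Matrix (Fin n) (Fin n) (CoordRing n O))
    ((univSigma n O ^ q :
      Matrix.GeneralLinearGroup (Fin n) (CoordRing n O)) : Matrix (Fin n) (Fin n) (CoordRing n O))

/-- The coordinate ring of `X ×_O F`. -/
abbrev SpecialFibreRing (n q : ℕ) (O E F : Type*) [CommRing O] [Field E] [Algebra O E]
    [Field F] [Algebra O F] : Type _ :=
  TensorProduct O F (CoordRing n O ⧸ steinbergTraceIdeal n q O E)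

/-- The canonical map from functions on `GL_n × GL_n` over `O` to functions on `X ×_O F`. -/
def toSpecialFibre (n q : ℕ) (O E F : Type*) [CommRing O] [Field E] [Algebra O E]
    [Field F] [Algebra O F] : CoordRing n O →ₐ[O] SpecialFibreRing n q O E F :=
  (Algebra.TensorProduct.includeRight :
    (CoordRing n O ⧸ steinbergTraceIdeal n q O E) →ₐ[O] SpecialFibreRing n q O E F).comp
    (Ideal.Quotient.mkₐ O (steinbergTraceIdeal n q O E))

/-- The coordinate ring of `𝔰𝔩₂ × 𝔰𝔩₂` over `F`, the first (second) copy of `𝔰𝔩₂` having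
coordinates `X (0, i)` (respectively `X (1, i)`), `i = 0, 1, 2`. -/
abbrev SlPairRing (F : Type*) [CommRing F] : Type _ :=
  MvPolynomial (Fin 2 × Fin 3) F

/-- The universal pair of trace-zero `2 × 2` matrices: `M = slPair F 0`, `N = slPair F 1`. -/
def slPair (F : Type*) [CommRing F] (k : Fin 2) : Matrix (Fin 2) (Fin 2) (SlPairRing F) :=
  !![MvPolynomial.X (k, 0), MvPolynomial.X (k, 1);
     MvPolynomial.X (k, 2), -MvPolynomial.X (k, 0)]

end SteinbergModuli

end

/-! Write `q = 2c + 1`, `N = Σ - 1` and `Φ = t (P + c + 1)` with `P` of trace zero. As `2` and `c +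
1` are units, the listed equations say exactly that `t = tr Φ / (1 + q)` is a unit and that `P² =
c²`, `N² = 0`, `PN = cN`, the last forcing `NP = -cN` (`SteinbergRel.scrollRel`,
`ScrollRel.steinbergRel`).

Over any base ring and for any `c`, these relations straighten every monomial to standard ones
(`monom_mem_span`). The standard monomials stay independent on the chart where the common eigenline
is spanned by `(1, -z)`, because their leading terms in `z` differ and have coefficients `±1`
(`linearCombination_monom_injective`). So the algebra of the relations embeds in the polynomial ring
in `w`, `s`, `z` (`aeval_eq_zero_of_toChart_eq_zero`).

Both halves follow. Over `O`, chart points with `s ≠ 0` and `t ≠ 0` over the algebraic closure have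
`Σ` regular unipotent. A function vanishing at all of them vanishes on the chart, hence modulo the
equations. Over `F` one has `q = 1`, so `c = 0`, `t = 1`, `P = M`, and the special fibre embeds in a
polynomial ring over a field, so it is reduced. -/

namespace SteinbergModuli

/-! ### Straightening monomials modulo the relations -/

/-- The equations `P ^ 2 = c ^ 2`, `N ^ 2 = 0`, `P * N = c * N` for trace-zero `2 × 2` matrices
`P`, `N` with coordinates `x (0, i)` and `x (1, i)`. -/
structure ScrollRel {B : Type*} [CommRing B] (c : B) (x : Fin 2 × Fin 3 → B) : Prop where
  sqP : x (0, 0) ^ 2 = c ^ 2 - x (0, 1) * x (0, 2)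
  sqN : x (1, 0) ^ 2 = -(x (1, 1) * x (1, 2))
  p0n0 : x (0, 0) * x (1, 0) = -(x (0, 2) * x (1, 1)) - c * x (1, 0)
  p0n1 : x (0, 0) * x (1, 1) = c * x (1, 1) + x (0, 1) * x (1, 0)
  p0n2 : x (0, 0) * x (1, 2) = x (0, 2) * x (1, 0) - c * x (1, 2)
  p1n2 : x (0, 1) * x (1, 2) = x (0, 2) * x (1, 1) + 2 * c * x (1, 0)

/-- Exponents of a monomial in the six coordinates of a pair of trace-zero matrices. -/
@[ext] structure ScrollExp where
  p0 : ℕ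
  p1 : ℕ
  p2 : ℕ
  n0 : ℕ
  n1 : ℕ
  n2 : ℕ

/-- The monomial with given exponents. -/
def ScrollExp.monom {B : Type*} [CommRing B] (x : Fin 2 × Fin 3 → B) (τ : ScrollExp) : B :=
  x (0, 0) ^ τ.p0 * x (0, 1) ^ τ.p1 * x (0, 2) ^ τ.p2 *
    (x (1, 0) ^ τ.n0 * x (1, 1) ^ τ.n1 * x (1, 2) ^ τ.n2)

/-- The standard monomials, which form a basis modulo the equations `ScrollRel`. -/
def stdExps : Set ScrollExp :=
  {τ | τ.p0 ≤ 1 ∧ τ.n0 ≤ 1 ∧ (τ.p0 = 0 ∨ τ.n0 = 0 ∧ τ.n1 = 0 ∧ τ.n2 = 0) ∧ (τ.p1 = 0 ∨ τ.n2 = 0)}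

section Spanning

variable {R B : Type*} [CommRing R] [CommRing B] [Algebra R B] {c : R} {x : Fin 2 × Fin 3 → B}

/-- Two rewritings are used: `sqN` lowers the exponent of `n0` and keeps that of `p1`, while `p1n2`
lowers the exponent of `p1` but may raise that of `n0`. Hence the outer induction is on `p1` and the
inner one on `n0`. -/
theorem monom_mem_span_of_p0_eq_zero (hx : ScrollRel (algebraMap R B c) x) (a : ℕ) :
    ∀ f b d e : ℕ, ScrollExp.monom x ⟨0, a, b, f, d, e⟩ ∈
      Submodule.span R (ScrollExp.monom x '' stdExps) := by
  induction a with
  | zero =>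
    intro f
    induction f using Nat.strong_induction_on with
    | _ f ih =>
      intro b d e
      obtain hf | hf := Nat.lt_or_ge 1 f
      · obtain ⟨f, rfl⟩ := Nat.exists_eq_add_of_le' hf
        have h := Submodule.neg_mem _ (ih f (by omega) b (d + 1) (e + 1))
        convert h using 1
        simp only [ScrollExp.monom]
        linear_combination (x (0, 2) ^ b * x (1, 0) ^ f * x (1, 1) ^ d * x (1, 2) ^ e) * hx.sqN
      · exact Submodule.subset_span ⟨_, by simp [stdExps, hf], rfl⟩
  | succ a iha =>
    intro f
    induction f using Nat.strong_induction_on with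
    | _ f ih =>
      intro b d e
      obtain hf | hf := Nat.lt_or_ge 1 f
      · obtain ⟨f, rfl⟩ := Nat.exists_eq_add_of_le' hf
        have h := Submodule.neg_mem _ (ih f (by omega) b (d + 1) (e + 1))
        convert h using 1
        simp only [ScrollExp.monom]
        linear_combination (x (0, 1) ^ (a + 1) * x (0, 2) ^ b * x (1, 0) ^ f * x (1, 1) ^ d *
          x (1, 2) ^ e) * hx.sqN
      · cases e with
        | zero => exact Submodule.subset_span ⟨_, by simp [stdExps, hf], rfl⟩
        | succ e =>
          have h := Submodule.add_mem _ (iha f (b + 1) (d + 1) e)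
            (Submodule.smul_mem _ (2 * c) (iha (f + 1) b d e))
          convert h using 1
          simp only [ScrollExp.monom, Algebra.smul_def, map_mul, map_ofNat]
          linear_combination (x (0, 1) ^ a * x (0, 2) ^ b * x (1, 0) ^ f * x (1, 1) ^ d *
            x (1, 2) ^ e) * hx.p1n2

/-- Squares of `p0` are removed by `sqP`, and a single `p0` is absorbed by any coordinate of `N`
present. Every rewriting lowers the exponent of `p0`, which reduces to the case without it. -/
theorem monom_mem_span (hx : ScrollRel (algebraMap R B c) x) (g : ℕ) :
    ∀ a b f d e : ℕ, ScrollExp.monom x ⟨g, a, b, f, d, e⟩ ∈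
      Submodule.span R (ScrollExp.monom x '' stdExps) := by
  induction g using Nat.strong_induction_on with
  | _ g ih =>
    intro a b f d e
    match g, ih with
    | 0, _ => exact monom_mem_span_of_p0_eq_zero hx _ _ _ _ _
    | g + 2, ih =>
      have h := Submodule.sub_mem _
        (Submodule.smul_mem _ (c ^ 2) (ih g (by omega) a b f d e))
        (ih g (by omega) (a + 1) (b + 1) f d e)
      convert h using 1
      simp only [ScrollExp.monom, Algebra.smul_def, map_pow]
      linear_combination (x (0, 0) ^ g * x (0, 1) ^ a * x (0, 2) ^ b * x (1, 0) ^ f *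
        x (1, 1) ^ d * x (1, 2) ^ e) * hx.sqP
    | 1, ih =>
      have h0 := ih 0 (by omega)
      match f, d, e with
      | f + 1, d, e =>
        have h := Submodule.sub_mem _ (Submodule.neg_mem _ (h0 a (b + 1) f (d + 1) e))
          (Submodule.smul_mem _ c (h0 a b (f + 1) d e))
        convert h using 1
        simp only [ScrollExp.monom, Algebra.smul_def]
        linear_combination (x (0, 1) ^ a * x (0, 2) ^ b * x (1, 0) ^ f *
          x (1, 1) ^ d * x (1, 2) ^ e) * hx.p0n0
      | 0, d + 1, e =>
        have h := Submodule.add_mem _ (Submodule.smul_mem _ c (h0 a b 0 (d + 1) e))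
          (h0 (a + 1) b 1 d e)
        convert h using 1
        simp only [ScrollExp.monom, Algebra.smul_def]
        linear_combination (x (0, 1) ^ a * x (0, 2) ^ b *
          x (1, 1) ^ d * x (1, 2) ^ e) * hx.p0n1
      | 0, 0, e + 1 =>
        have h := Submodule.sub_mem _ (h0 a (b + 1) 1 0 e)
          (Submodule.smul_mem _ c (h0 a b 0 0 (e + 1)))
        convert h using 1
        simp only [ScrollExp.monom, Algebra.smul_def]
        linear_combination (x (0, 1) ^ a * x (0, 2) ^ b * x (1, 2) ^ e) * hx.p0n2
      | 0, 0, 0 => exact Submodule.subset_span ⟨_, by simp [stdExps], rfl⟩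

theorem aeval_mem_span_monom (hx : ScrollRel (algebraMap R B c) x)
    (p : MvPolynomial (Fin 2 × Fin 3) R) :
    MvPolynomial.aeval x p ∈ Submodule.span R (ScrollExp.monom x '' stdExps) := by
  rw [MvPolynomial.aeval_def, MvPolynomial.eval₂_eq']
  refine Submodule.sum_mem _ fun τ _ => ?_
  rw [← Algebra.smul_def]
  refine Submodule.smul_mem _ _ ?_
  convert monom_mem_span hx (τ (0, 0)) (τ (0, 1)) (τ (0, 2)) (τ (1, 0)) (τ (1, 1)) (τ (1, 2))
    using 1
  simp [Fintype.prod_prod_type, Fin.prod_univ_succ, ScrollExp.monom]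
  ring

end Spanning

/-! ### The chart and independence of standard monomials -/

open Polynomial

/-- The coordinates of the pairs `(P, N)` satisfying `ScrollRel c` on the chart where the common
eigenline is spanned by a vector with first coordinate `1`. -/
def chart {B : Type*} [CommRing B] (c w s z : B) (v : Fin 2 × Fin 3) : B :=
  if v.1 = 0 then ![c + z * w, w, -(2 * c * z) - z ^ 2 * w] v.2
  else ![z * s, s, -(z ^ 2 * s)] v.2

section chart

variable {B : Type*} [CommRing B] (c w s z : B)

@[simp] theorem chart_00 : chart c w s z (0, 0) = c + z * w := rfl
@[simp] theorem chart_01 : chart c w s z (0, 1) = w := rfl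
@[simp] theorem chart_02 : chart c w s z (0, 2) = -(2 * c * z) - z ^ 2 * w := rfl
@[simp] theorem chart_10 : chart c w s z (1, 0) = z * s := rfl
@[simp] theorem chart_11 : chart c w s z (1, 1) = s := rfl
@[simp] theorem chart_12 : chart c w s z (1, 2) = -(z ^ 2 * s) := rfl

theorem scrollRel_chart : ScrollRel c (chart c w s z) := by
  constructor <;> simp <;> ring

theorem map_chart {B' : Type*} [CommRing B'] (f : B →+* B') (v : Fin 2 × Fin 3) :
    f (chart c w s z v) = chart (f c) (f w) (f s) (f z) v := by
  obtain ⟨i, j⟩ := v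
  have h2 : f 2 = 2 := map_ofNat f 2
  fin_cases i <;> fin_cases j <;> simp [chart, h2]

end chart

/-- The coordinate ring of the chart. -/
abbrev ChartRing (R : Type*) [CommRing R] : Type _ := (MvPolynomial (Fin 2) R)[X]

/-- The generic point of the chart. -/
noncomputable def genericChart {R : Type*} [CommRing R] (c : R) : Fin 2 × Fin 3 → ChartRing R :=
  chart (C (MvPolynomial.C c)) (C (MvPolynomial.X 0)) (C (MvPolynomial.X 1)) X

/-- Pullback of functions to the chart. -/
noncomputable def toChart {R : Type*} [CommRing R] (c : R) :
    MvPolynomial (Fin 2 × Fin 3) R →ₐ[R] ChartRing R :=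
  MvPolynomial.aeval (genericChart c)

/-- The degree in `z` of the restriction of a monomial to the chart. -/
def ScrollExp.zdeg (τ : ScrollExp) : ℕ := τ.p0 + 2 * τ.p2 + (τ.n0 + 2 * τ.n2)

section leading

variable {S : Type*} [CommRing S]

theorem natDegree_mul_le_and_coeff {p q : S[X]} {m n : ℕ} {a b : S}
    (hp : p.natDegree ≤ m ∧ p.coeff m = a) (hq : q.natDegree ≤ n ∧ q.coeff n = b) :
    (p * q).natDegree ≤ m + n ∧ (p * q).coeff (m + n) = a * b :=
  ⟨natDegree_mul_le_of_le hp.1 hq.1, by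
    rw [coeff_mul_add_eq_of_natDegree_le hp.1 hq.1, hp.2, hq.2]⟩

theorem natDegree_pow_le_and_coeff {p : S[X]} {m : ℕ} {a : S}
    (hp : p.natDegree ≤ m ∧ p.coeff m = a) (k : ℕ) :
    (p ^ k).natDegree ≤ k * m ∧ (p ^ k).coeff (k * m) = a ^ k :=
  ⟨natDegree_pow_le_of_le k hp.1, by
    rw [coeff_pow_of_natDegree_le hp.1, hp.2]⟩

end leading

/-- In each coordinate the top coefficient in `z` is `±w` or `±s` and does not involve `c`. This
makes the independence argument uniform in the base ring and in `c`. -/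
theorem monom_genericChart {R : Type*} [CommRing R] (c : R) (τ : ScrollExp) :
    (τ.monom (genericChart c)).natDegree ≤ τ.zdeg ∧
    (τ.monom (genericChart c)).coeff τ.zdeg =
      MvPolynomial.monomial
        (Finsupp.single 0 (τ.p0 + τ.p1 + τ.p2) + Finsupp.single 1 (τ.n0 + τ.n1 + τ.n2))
        ((-1) ^ (τ.p2 + τ.n2)) := by
  set w : MvPolynomial (Fin 2) R := MvPolynomial.X 0 with hw
  set s : MvPolynomial (Fin 2) R := MvPolynomial.X 1 with hs
  have h00 : (genericChart c (0, 0)).natDegree ≤ 1 ∧ (genericChart c (0, 0)).coeff 1 = w := by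
    simp only [genericChart, chart_00]
    exact ⟨by compute_degree, by simp [coeff_C, hw]⟩
  have h01 : (genericChart c (0, 1)).natDegree ≤ 0 ∧ (genericChart c (0, 1)).coeff 0 = w := by
    simp [genericChart, hw]
  have h02 : (genericChart c (0, 2)).natDegree ≤ 2 ∧ (genericChart c (0, 2)).coeff 2 = -w := by
    simp only [genericChart, chart_02]
    have h2 : (2 : ChartRing R) * C (MvPolynomial.C c) * X = C (2 * MvPolynomial.C c) * X := by
      rw [C_mul, C_ofNat]
    rw [h2]
    exact ⟨by compute_degree, by simp [hw, -map_mul]⟩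
  have h10 : (genericChart c (1, 0)).natDegree ≤ 1 ∧ (genericChart c (1, 0)).coeff 1 = s := by
    simp only [genericChart, chart_10]
    exact ⟨by compute_degree, by simp [hs]⟩
  have h11 : (genericChart c (1, 1)).natDegree ≤ 0 ∧ (genericChart c (1, 1)).coeff 0 = s := by
    simp [genericChart, hs]
  have h12 : (genericChart c (1, 2)).natDegree ≤ 2 ∧ (genericChart c (1, 2)).coeff 2 = -s := by
    simp only [genericChart, chart_12]
    exact ⟨by compute_degree, by simp [hs]⟩
  have H := natDegree_mul_le_and_coeff
    (natDegree_mul_le_and_coeff (natDegree_mul_le_and_coeff (natDegree_pow_le_and_coeff h00 τ.p0)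
      (natDegree_pow_le_and_coeff h01 τ.p1)) (natDegree_pow_le_and_coeff h02 τ.p2))
    (natDegree_mul_le_and_coeff (natDegree_mul_le_and_coeff (natDegree_pow_le_and_coeff h10 τ.n0)
      (natDegree_pow_le_and_coeff h11 τ.n1)) (natDegree_pow_le_and_coeff h12 τ.n2))
  have hd : τ.p0 * 1 + τ.p1 * 0 + τ.p2 * 2 + (τ.n0 * 1 + τ.n1 * 0 + τ.n2 * 2) = τ.zdeg := by
    simp only [ScrollExp.zdeg]; ring
  rw [hd] at H
  refine ⟨H.1, H.2.trans ?_⟩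
  have hm : ∀ (i j : ℕ) (a : R), MvPolynomial.monomial
      (Finsupp.single (0 : Fin 2) i + Finsupp.single 1 j) a = MvPolynomial.C a * w ^ i * s ^ j := by
    intro i j a
    rw [MvPolynomial.monomial_add_single, hw, hs, MvPolynomial.C_mul_X_pow_eq_monomial]
  rw [hm, map_pow, map_neg, map_one, neg_pow w, neg_pow s]
  ring

/-- A standard monomial is determined by its degree in `P`, its degree in `N` and its `z`-degree:
within one bidegree the `z`-degrees are pairwise distinct. The coefficient of a monomial of maximal
`z`-degree can therefore be read off, up to sign, from a single coefficient on the chart. -/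
theorem linearCombination_monom_injective {R : Type*} [CommRing R] (c : R) (r : ScrollExp →₀ R)
    (hr : ∀ τ ∈ r.support, τ ∈ stdExps)
    (h : Finsupp.linearCombination R (ScrollExp.monom (genericChart c)) r = 0) : r = 0 := by
  by_contra hne
  obtain ⟨τ, hτ, hmax⟩ := r.support.exists_max_image ScrollExp.zdeg
    (Finsupp.support_nonempty_iff.2 hne)
  have h1 := congrArg (fun p : ChartRing R => MvPolynomial.coeff
    (Finsupp.single 0 (τ.p0 + τ.p1 + τ.p2) + Finsupp.single 1 (τ.n0 + τ.n1 + τ.n2))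
    (p.coeff τ.zdeg)) h
  simp only [Finsupp.linearCombination_apply, Finsupp.sum, finsetSum_coeff, coeff_smul,
    MvPolynomial.coeff_sum, MvPolynomial.coeff_smul, coeff_zero, MvPolynomial.coeff_zero] at h1
  rw [Finset.sum_eq_single τ] at h1
  · rw [(monom_genericChart c τ).2, MvPolynomial.coeff_monomial, if_pos rfl, smul_eq_mul] at h1
    have hu : IsUnit ((-1 : R) ^ (τ.p2 + τ.n2)) := (isUnit_one.neg).pow _
    exact Finsupp.mem_support_iff.1 hτ (hu.mul_left_eq_zero.1 h1)
  · intro σ hσ hne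
    rcases (hmax σ hσ).lt_or_eq with hlt | heq
    · rw [coeff_eq_zero_of_natDegree_lt ((monom_genericChart c σ).1.trans_lt hlt)]
      simp
    · rw [← heq, (monom_genericChart c σ).2, MvPolynomial.coeff_monomial, if_neg, smul_zero]
      intro hE
      have e0 := DFunLike.congr_fun hE 0
      have e1 := DFunLike.congr_fun hE 1
      simp only [Finsupp.coe_add, Pi.add_apply, Finsupp.single_apply] at e0 e1
      simp at e0 e1
      obtain ⟨s1, s2, s3, s4⟩ := hr σ hσ
      obtain ⟨t1, t2, t3, t4⟩ := hr τ hτ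
      simp only [ScrollExp.zdeg] at heq
      apply hne
      ext <;> omega
  · exact fun hn => absurd hτ hn

/-- A function which restricts to zero on the chart vanishes wherever `ScrollRel` holds. -/
theorem aeval_eq_zero_of_toChart_eq_zero {R B : Type*} [CommRing R] [CommRing B] [Algebra R B]
    {c : R} {x : Fin 2 × Fin 3 → B} (hx : ScrollRel (algebraMap R B c) x)
    {p : MvPolynomial (Fin 2 × Fin 3) R} (hp : toChart c p = 0) :
    MvPolynomial.aeval x p = 0 := by
  -- Straightening in the product ring gives one set of coefficients valid in `B` and on the chart
  -- at once. The chart component forces them to vanish, and the `B` component then gives the claim.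
  set y : Fin 2 × Fin 3 → B × ChartRing R := fun v => (x v, genericChart c v)
  have hg : ScrollRel (algebraMap R (ChartRing R) c) (genericChart c) := scrollRel_chart _ _ _ _
  have hy : ScrollRel (algebraMap R (B × ChartRing R) c) y :=
    ⟨Prod.ext hx.sqP hg.sqP, Prod.ext hx.sqN hg.sqN, Prod.ext hx.p0n0 hg.p0n0,
      Prod.ext hx.p0n1 hg.p0n1, Prod.ext hx.p0n2 hg.p0n2, Prod.ext hx.p1n2 hg.p1n2⟩
  obtain ⟨r, hr, hrp⟩ := (Finsupp.mem_span_image_iff_linearCombination R).1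
    (aeval_mem_span_monom hy p)
  have h2 : Finsupp.linearCombination R (ScrollExp.monom (genericChart c)) r = toChart c p := by
    have hm : (AlgHom.snd R B (ChartRing R)).toLinearMap ∘ ScrollExp.monom y =
        ScrollExp.monom (genericChart c) := by
      funext τ
      simp [ScrollExp.monom, y]
    have h := congrArg (AlgHom.snd R B (ChartRing R)) hrp
    rw [← AlgHom.comp_apply, MvPolynomial.comp_aeval, ← AlgHom.coe_toLinearMap,
      Finsupp.apply_linearCombination, hm] at h
    exact h
  have hr0 := linearCombination_monom_injective c r
    (fun τ hτ => Finsupp.mem_supported R r |>.1 hr hτ) (h2.trans hp)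
  have h1 := congrArg (AlgHom.fst R B (ChartRing R)) hrp
  rw [← AlgHom.comp_apply, MvPolynomial.comp_aeval, hr0, map_zero, map_zero] at h1
  exact h1.symm

/-! ### Translation between `(Φ, Σ)` and `(P, N)` -/

open Matrix

section Relations

variable {B : Type*} [CommRing B]

theorem one_add_pow_of_sq_eq_zero {A : Type*} [Ring A] {N : A} (hN : N * N = 0) (k : ℕ) :
    (1 + N) ^ k = 1 + (k : A) * N := by
  induction k with
  | zero => simp
  | succ k ih =>
    rw [pow_succ, ih]
    have h : (1 + (k : A) * N) * (1 + N) = 1 + ((k + 1 : ℕ) : A) * N + k * (N * N) := by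
      push_cast; noncomm_ring
    rw [h, hN, mul_zero, add_zero]

/-- The equations satisfied by the pairs `(Φ, Σ)` on the Steinberg component. -/
structure SteinbergRel (q : ℕ) (Φ S : Matrix (Fin 2) (Fin 2) B) : Prop where
  conj : Φ * S = S ^ q * Φ
  trace_sq : (q : B) * Φ.trace ^ 2 = (1 + q) ^ 2 * Φ.det
  trace_snd : S.trace = 2
  det_snd : S.det = 1
  trace_mul : (Φ * (S - 1)).trace = 0

theorem sub_one_mul_sub_one_eq_zero {S : Matrix (Fin 2) (Fin 2) B} (ht : S.trace = 2)
    (hd : S.det = 1) : (S - 1) * (S - 1) = 0 := by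
  rw [trace_fin_two] at ht
  rw [det_fin_two] at hd
  ext i j
  fin_cases i <;> fin_cases j <;> simp [mul_apply, Fin.sum_univ_two]
  · linear_combination S 0 0 * ht - hd
  · linear_combination S 0 1 * ht
  · linear_combination S 1 0 * ht
  · linear_combination S 1 1 * ht - hd

/-- Since `(S - 1)² = 0`, the power `S ^ q` is `1 + q (S - 1)`, so the conjugation equation becomes
linear in `S - 1`. -/
theorem conj_iff {q : ℕ} {Φ S : Matrix (Fin 2) (Fin 2) B} (ht : S.trace = 2) (hd : S.det = 1) :
    Φ * S = S ^ q * Φ ↔ Φ * (S - 1) = (q : Matrix (Fin 2) (Fin 2) B) * (S - 1) * Φ := by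
  have h := one_add_pow_of_sq_eq_zero (sub_one_mul_sub_one_eq_zero ht hd) q
  rw [add_sub_cancel] at h
  have hΦ : Φ * (S - 1) = Φ * S - Φ := by rw [mul_sub, mul_one]
  rw [h, hΦ, add_mul, one_mul, sub_eq_iff_eq_add']

theorem conj_entries {q : ℕ} {Φ S : Matrix (Fin 2) (Fin 2) B}
    (h : Φ * (S - 1) = (q : Matrix (Fin 2) (Fin 2) B) * (S - 1) * Φ) :
    Φ 0 0 * (S 0 0 - 1) + Φ 0 1 * S 1 0 = q * ((S 0 0 - 1) * Φ 0 0 + S 0 1 * Φ 1 0) ∧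
    Φ 0 0 * S 0 1 + Φ 0 1 * (S 1 1 - 1) = q * ((S 0 0 - 1) * Φ 0 1 + S 0 1 * Φ 1 1) ∧
    Φ 1 0 * (S 0 0 - 1) + Φ 1 1 * S 1 0 = q * (S 1 0 * Φ 0 0 + (S 1 1 - 1) * Φ 1 0) ∧
    Φ 1 0 * S 0 1 + Φ 1 1 * (S 1 1 - 1) = q * (S 1 0 * Φ 0 1 + (S 1 1 - 1) * Φ 1 1) := by
  have h' : ∀ i j, (Φ * (S - 1)) i j = q * (((S - 1) * Φ) i j) := by
    intro i j
    rw [h, mul_assoc, ← nsmul_eq_mul, Matrix.smul_apply, nsmul_eq_mul]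
  have h00 := h' 0 0
  have h01 := h' 0 1
  have h10 := h' 1 0
  have h11 := h' 1 1
  simp [mul_apply, Fin.sum_univ_two] at h00 h01 h10 h11
  exact ⟨h00, h01, h10, h11⟩

/-- The trace-zero matrix with coordinates `x (i, 0)`, `x (i, 1)`, `x (i, 2)`. -/
def slMat (x : Fin 2 × Fin 3 → B) (i : Fin 2) : Matrix (Fin 2) (Fin 2) B :=
  !![x (i, 0), x (i, 1); x (i, 2), -x (i, 0)]

/-- The coordinates of the pair `(u Φ - h, S - 1)`. -/
def pairCoords (u h : B) (Φ S : Matrix (Fin 2) (Fin 2) B) (v : Fin 2 × Fin 3) : B :=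
  if v.1 = 0 then ![u * Φ 0 0 - h, u * Φ 0 1, u * Φ 1 0] v.2
  else ![S 0 0 - 1, S 0 1, S 1 0] v.2

/-- The matrix `t (P + h)`. -/
def phiOf (t h : B) (x : Fin 2 × Fin 3 → B) : Matrix (Fin 2) (Fin 2) B := t • (slMat x 0 + h • 1)

/-- The matrix `1 + N`. -/
def sigmaOf (x : Fin 2 × Fin 3 → B) : Matrix (Fin 2) (Fin 2) B := 1 + slMat x 1

theorem pairCoords_phiOf {u t : B} (hut : u * t = 1) (h : B) (x : Fin 2 × Fin 3 → B) :
    pairCoords u h (phiOf t h x) (sigmaOf x) = x := by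
  have e : ∀ a, u * (t * a) = a := fun a => by rw [← mul_assoc, hut, one_mul]
  funext ⟨i, j⟩
  fin_cases i <;> fin_cases j <;> simp [pairCoords, phiOf, sigmaOf, slMat, e]

theorem phiOf_pairCoords {u t h : B} (hut : u * t = 1) {Φ S : Matrix (Fin 2) (Fin 2) B}
    (hΦ : Φ.trace = 2 * h * t) : phiOf t h (pairCoords u h Φ S) = Φ := by
  rw [trace_fin_two] at hΦ
  ext i j
  fin_cases i <;> fin_cases j <;> simp [pairCoords, phiOf, slMat]
  · linear_combination Φ 0 0 * hut
  · linear_combination Φ 0 1 * hut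
  · linear_combination Φ 1 0 * hut
  · linear_combination -hΦ - (Φ 0 0) * hut

theorem sigmaOf_pairCoords (u h : B) {Φ S : Matrix (Fin 2) (Fin 2) B} (hS : S.trace = 2) :
    sigmaOf (pairCoords u h Φ S) = S := by
  rw [trace_fin_two] at hS
  ext i j
  fin_cases i <;> fin_cases j <;> simp [pairCoords, sigmaOf, slMat]
  linear_combination -hS

theorem trace_phiOf (t h : B) (x : Fin 2 × Fin 3 → B) : (phiOf t h x).trace = 2 * h * t := by
  simp [phiOf, slMat, trace_fin_two]
  ring

theorem det_phiOf {c : B} {x : Fin 2 × Fin 3 → B} (hx : ScrollRel c x) (t : B) :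
    (phiOf t (c + 1) x).det = t ^ 2 * (2 * c + 1) := by
  simp [phiOf, slMat, det_fin_two]
  linear_combination -t ^ 2 * hx.sqP

theorem trace_sigmaOf (x : Fin 2 × Fin 3 → B) : (sigmaOf x).trace = 2 := by
  simp [sigmaOf, slMat, trace_fin_two]

theorem det_sigmaOf {c : B} {x : Fin 2 × Fin 3 → B} (hx : ScrollRel c x) :
    (sigmaOf x).det = 1 := by
  simp [sigmaOf, slMat, det_fin_two]
  linear_combination -hx.sqN

/-- The shift `c + 1` is chosen so that the eigenvalues `±c` of `P` become `tq` and `t` for `Φ`. -/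
theorem ScrollRel.steinbergRel {c : B} {x : Fin 2 × Fin 3 → B} (hx : ScrollRel c x) (t : B)
    {q : ℕ} (hq : (q : B) = 2 * c + 1) : SteinbergRel q (phiOf t (c + 1) x) (sigmaOf x) where
  conj := by
    rw [conj_iff (trace_sigmaOf x) (det_sigmaOf hx), mul_assoc, ← nsmul_eq_mul]
    ext i j
    rw [Matrix.smul_apply, nsmul_eq_mul, hq]
    fin_cases i <;> fin_cases j <;>
      simp [phiOf, sigmaOf, slMat, mul_apply, Fin.sum_univ_two]
    · linear_combination t * (-2 * c) * hx.p0n0 + t * hx.p1n2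
    · linear_combination t * (2 + 2 * c) * hx.p0n1
    · linear_combination t * (-2 - 2 * c) * hx.p0n2
    · linear_combination t * (-2 * c) * hx.p0n0 - t * (2 * c + 1) * hx.p1n2
  trace_sq := by
    rw [trace_phiOf, det_phiOf hx, hq]; ring
  trace_snd := trace_sigmaOf x
  det_snd := det_sigmaOf hx
  trace_mul := by
    simp [phiOf, sigmaOf, slMat, mul_apply, Fin.sum_univ_two, trace_fin_two]
    linear_combination 2 * t * hx.p0n0 + t * hx.p1n2

theorem SteinbergRel.scrollRel {q : ℕ} {Φ S : Matrix (Fin 2) (Fin 2) B} (H : SteinbergRel q Φ S)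
    {c u t : B} (hq : (q : B) = 2 * c + 1) (h2 : IsUnit (2 : B)) (hc : IsUnit (c + 1))
    (hut : u * t = 1) (ht : Φ.trace = 2 * (c + 1) * t) :
    ScrollRel c (pairCoords u (c + 1) Φ S) := by
  obtain ⟨e00, e01, e10, e11⟩ := conj_entries ((conj_iff H.trace_snd H.det_snd).1 H.conj)
  have hS := H.trace_snd
  have hdS := H.det_snd
  have htm := H.trace_mul
  have hts := H.trace_sq
  rw [ht] at hts
  rw [trace_fin_two] at hS ht
  rw [det_fin_two] at hdS hts
  simp [mul_apply, Fin.sum_univ_two, trace_fin_two] at htm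
  rw [hq] at e00 e01 e10 e11 hts
  -- Cancelling `(1 + q)² = (2 (c + 1))²` leaves `det Φ = q t²`, which is the relation `P² = c²`.
  have hd : Φ 0 0 * Φ 1 1 - Φ 0 1 * Φ 1 0 = (2 * c + 1) * t ^ 2 := by
    have hu : IsUnit ((2 * (c + 1)) ^ 2) := (h2.mul hc).pow 2
    refine hu.mul_left_cancel ?_
    linear_combination -hts
  have hu : IsUnit (2 * (c + 1)) := h2.mul hc
  have S11 : S 1 1 = 2 - S 0 0 := by linear_combination hS
  have Φ11 : Φ 1 1 = 2 * (c + 1) * t - Φ 0 0 := by linear_combination ht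
  rw [S11] at e01 e10 e11 htm hdS
  rw [Φ11] at e01 e10 htm hd
  have p0n0 : (u * Φ 0 0 - (c + 1)) * (S 0 0 - 1) =
      -(u * Φ 1 0 * S 0 1) - c * (S 0 0 - 1) := by
    refine hu.mul_left_cancel ?_
    linear_combination u * htm - u * e00 + 2 * (c + 1) * (S 0 0 - 1) * hut
  have ht' : 2 * ((u * Φ 0 0 - (c + 1)) * (S 0 0 - 1)) + u * Φ 0 1 * S 1 0
      + u * Φ 1 0 * S 0 1 = 0 := by
    linear_combination u * htm + 2 * (c + 1) * (S 0 0 - 1) * hut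
  refine ⟨?_, ?_, ?_, ?_, ?_, ?_⟩ <;> simp only [pairCoords] <;> simp
  · linear_combination -u ^ 2 * hd + (2 * u * Φ 0 0 * (c + 1) - (2 * c + 1) * (u * t + 1)) * hut
  · linear_combination -hdS
  · linear_combination p0n0
  · refine hu.mul_left_cancel ?_
    linear_combination u * e01 + 2 * (c + 1) * (2 * c + 1) * S 0 1 * hut
  · refine hu.mul_left_cancel ?_
    linear_combination -u * e10 + 2 * (c + 1) * S 1 0 * hut
  · linear_combination ht' - 2 * p0n0

end Relations

/-! ### Ideals tested on homomorphisms out of the coordinate ring -/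

open Matrix

section Ideals

variable {B : Type*} [CommRing B]

theorem charpoly_eq_mul_iff (M : Matrix (Fin 2) (Fin 2) B) (a b : B) :
    M.charpoly = (Polynomial.X - Polynomial.C a) * (Polynomial.X - Polynomial.C b) ↔
      M.trace = a + b ∧ M.det = a * b := by
  nontriviality B
  rw [charpoly_fin_two]
  have h : (Polynomial.X - Polynomial.C a) * (Polynomial.X - Polynomial.C b) =
      Polynomial.X ^ 2 - Polynomial.C (a + b) * Polynomial.X + Polynomial.C (a * b) := by
    rw [Polynomial.C_add, Polynomial.C_mul]; ring
  rw [h]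
  constructor
  · intro h
    have h0 := congrArg (Polynomial.coeff · 0) h
    have h1 := congrArg (Polynomial.coeff · 1) h
    simp [-map_add, -map_mul, Polynomial.coeff_X, Polynomial.coeff_C] at h0 h1
    exact ⟨by linear_combination -h1, h0⟩
  · rintro ⟨h1, h2⟩
    rw [h1, h2]

/-- This and the analogues below replace ideals by conditions on the pair classified by `x`. Two
ideals agree once the same `x` kill them. -/
theorem matrixEqIdeal_le_ker_iff {A : Type*} [CommRing A] {n : ℕ} (x : A →+* B)
    (M N : Matrix (Fin n) (Fin n) A) :
    matrixEqIdeal M N ≤ RingHom.ker x ↔ M.map x = N.map x := by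
  rw [matrixEqIdeal, Ideal.span_le, Set.range_subset_iff]
  simp only [SetLike.mem_coe, RingHom.mem_ker, map_sub, sub_eq_zero, Prod.forall]
  exact ⟨fun h => Matrix.ext h, fun h i j => congrFun (congrFun h i) j⟩

theorem polyEqIdeal_le_ker_iff {A : Type*} [CommRing A] (x : A →+* B) (f g : Polynomial A) :
    polyEqIdeal f g ≤ RingHom.ker x ↔ f.map x = g.map x := by
  rw [polyEqIdeal, Ideal.span_le, Set.range_subset_iff, Polynomial.ext_iff]
  simp only [SetLike.mem_coe, RingHom.mem_ker, map_sub, sub_eq_zero, Polynomial.coeff_map]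

theorem span_singleton_le_ker_iff {A : Type*} [CommRing A] (x : A →+* B) (a : A) :
    Ideal.span {a} ≤ RingHom.ker x ↔ x a = 0 := by
  rw [Ideal.span_singleton_le_iff_mem, RingHom.mem_ker]

variable {O : Type*} [CommRing O]

/-- The first component of the pair of matrices classified by `x`. -/
noncomputable def phiAt (x : CoordRing 2 O →+* B) : Matrix (Fin 2) (Fin 2) B :=
  (univPhi 2 O).val.map x

/-- The second component of the pair of matrices classified by `x`. -/
noncomputable def sigmaAt (x : CoordRing 2 O →+* B) : Matrix (Fin 2) (Fin 2) B :=
  (univSigma 2 O).val.map x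

theorem isUnit_det_phiAt (x : CoordRing 2 O →+* B) : IsUnit (phiAt x).det := by
  have h := ((Matrix.isUnit_iff_isUnit_det _).1 (univPhi 2 O).isUnit).map x
  rwa [RingHom.map_det] at h

theorem isUnit_det_sigmaAt (x : CoordRing 2 O →+* B) : IsUnit (sigmaAt x).det := by
  have h := ((Matrix.isUnit_iff_isUnit_det _).1 (univSigma 2 O).isUnit).map x
  rwa [RingHom.map_det] at h

theorem map_conj_iff (x : CoordRing 2 O →+* B) (q : ℕ) :
    GeneralLinearGroup.map x (univPhi 2 O) * GeneralLinearGroup.map x (univSigma 2 O) *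
      (GeneralLinearGroup.map x (univPhi 2 O))⁻¹ = GeneralLinearGroup.map x (univSigma 2 O) ^ q ↔
    phiAt x * sigmaAt x = sigmaAt x ^ q * phiAt x := by
  rw [mul_inv_eq_iff_eq_mul, ← Units.val_inj]
  rfl

theorem conjIdeal_le_ker_iff (x : CoordRing 2 O →+* B) (q : ℕ) :
    conjIdeal 2 q O ≤ RingHom.ker x ↔ phiAt x * sigmaAt x = sigmaAt x ^ q * phiAt x := by
  rw [conjIdeal, matrixEqIdeal_le_ker_iff, ← map_conj_iff, ← map_inv, ← map_mul, ← map_mul,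
    ← map_pow, ← Units.val_inj]
  rfl

/-- The ideal of the equations of the Steinberg component. -/
noncomputable def steinbergEqIdeal (q : ℕ) (O : Type*) [CommRing O] : Ideal (CoordRing 2 O) :=
  conjIdeal 2 q O ⊔
    Ideal.span {(q : CoordRing 2 O) * (univPhi 2 O).val.trace ^ 2 -
      (1 + (q : CoordRing 2 O)) ^ 2 * (univPhi 2 O).val.det} ⊔
    polyEqIdeal (univSigma 2 O).val.charpoly ((Polynomial.X - 1) ^ 2) ⊔
    Ideal.span {Matrix.trace ((univPhi 2 O).val * ((univSigma 2 O).val - 1))}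

/-- The ideal of the equations of the fixed trace part of the Steinberg component. -/
noncomputable def steinbergTraceEqIdeal (q : ℕ) (O : Type*) [CommRing O] : Ideal (CoordRing 2 O) :=
  conjIdeal 2 q O ⊔
    polyEqIdeal (univPhi 2 O).val.charpoly
      ((Polynomial.X - 1) * (Polynomial.X - Polynomial.C (q : CoordRing 2 O))) ⊔
    polyEqIdeal (univSigma 2 O).val.charpoly ((Polynomial.X - 1) ^ 2) ⊔
    Ideal.span {Matrix.trace ((univPhi 2 O).val * ((univSigma 2 O).val - 1))}

theorem map_trace_univPhi (x : CoordRing 2 O →+* B) :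
    x (univPhi 2 O).val.trace = (phiAt x).trace := AddMonoidHom.map_trace x.toAddMonoidHom _

theorem map_trace_mul (x : CoordRing 2 O →+* B) :
    x (Matrix.trace ((univPhi 2 O).val * ((univSigma 2 O).val - 1))) =
      (phiAt x * (sigmaAt x - 1)).trace := by
  have h : phiAt x * (sigmaAt x - 1) =
      x.mapMatrix ((univPhi 2 O).val * ((univSigma 2 O).val - 1)) := by
    rw [map_mul, map_sub, map_one]; rfl
  rw [h]
  exact AddMonoidHom.map_trace x.toAddMonoidHom _

theorem charpolySigma_le_ker_iff (x : CoordRing 2 O →+* B) :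
    polyEqIdeal (univSigma 2 O).val.charpoly ((Polynomial.X - 1) ^ 2) ≤ RingHom.ker x ↔
      (sigmaAt x).trace = 2 ∧ (sigmaAt x).det = 1 := by
  have h := charpoly_eq_mul_iff (sigmaAt x) 1 1
  rw [one_add_one_eq_two, one_mul] at h
  rw [polyEqIdeal_le_ker_iff, ← h, ← Matrix.charpoly_map]
  simp [sigmaAt, sq]

theorem charpolyPhi_le_ker_iff (x : CoordRing 2 O →+* B) (q : ℕ) :
    polyEqIdeal (univPhi 2 O).val.charpoly
      ((Polynomial.X - 1) * (Polynomial.X - Polynomial.C (q : CoordRing 2 O))) ≤ RingHom.ker x ↔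
      (phiAt x).trace = 1 + q ∧ (phiAt x).det = q := by
  have h := charpoly_eq_mul_iff (phiAt x) 1 q
  rw [one_mul] at h
  rw [polyEqIdeal_le_ker_iff, ← h, ← Matrix.charpoly_map]
  simp [phiAt]

theorem steinbergEqIdeal_le_ker_iff (x : CoordRing 2 O →+* B) (q : ℕ) :
    steinbergEqIdeal q O ≤ RingHom.ker x ↔ SteinbergRel q (phiAt x) (sigmaAt x) := by
  have h2 : x ((univPhi 2 O).val.det) = (phiAt x).det := RingHom.map_det x _
  rw [steinbergEqIdeal, sup_le_iff, sup_le_iff, sup_le_iff, conjIdeal_le_ker_iff,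
    span_singleton_le_ker_iff, span_singleton_le_ker_iff, charpolySigma_le_ker_iff, map_trace_mul,
    map_sub, map_mul, map_mul, map_pow, map_pow, map_add, map_one, map_natCast, sub_eq_zero, h2,
    map_trace_univPhi]
  exact ⟨fun ⟨⟨⟨h1, h2⟩, h3, h4⟩, h5⟩ => ⟨h1, h2, h3, h4, h5⟩,
    fun ⟨h1, h2, h3, h4, h5⟩ => ⟨⟨⟨h1, h2⟩, h3, h4⟩, h5⟩⟩

theorem steinbergTraceEqIdeal_le_ker_iff {q : ℕ} (h1q : IsUnit (1 + q : O))
    (x : CoordRing 2 O →+* B) :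
    steinbergTraceEqIdeal q O ≤ RingHom.ker x ↔
      SteinbergRel q (phiAt x) (sigmaAt x) ∧ (phiAt x).trace = 1 + q := by
  have hu : IsUnit ((1 + q : B) ^ 2) := by
    have h := (h1q.map (x.comp (algebraMap O (CoordRing 2 O)))).pow 2
    rwa [map_add, map_one, map_natCast] at h
  rw [steinbergTraceEqIdeal, sup_le_iff, sup_le_iff, sup_le_iff, conjIdeal_le_ker_iff,
    span_singleton_le_ker_iff, charpolySigma_le_ker_iff, charpolyPhi_le_ker_iff, map_trace_mul]
  constructor
  · rintro ⟨⟨⟨h1, ht, hd⟩, h3, h4⟩, h5⟩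
    exact ⟨⟨h1, by rw [ht, hd]; ring, h3, h4, h5⟩, ht⟩
  · rintro ⟨⟨h1, h2, h3, h4, h5⟩, ht⟩
    -- With `tr Φ = 1 + q` the equation reads `q (1 + q)² = (1 + q)² det Φ`, so invertibility of `1
    -- + q` gives `det Φ = q`.
    refine ⟨⟨⟨h1, ht, hu.mul_left_cancel ?_⟩, h3, h4⟩, h5⟩
    rw [← h2, ht, mul_comm]

theorem steinbergTraceEqIdeal_eq {q : ℕ} (h1q : IsUnit (1 + q : O)) :
    steinbergEqIdeal q O ⊔ Ideal.span {(univPhi 2 O).val.trace -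
      ∑ i ∈ Finset.range 2, (q : CoordRing 2 O) ^ i} = steinbergTraceEqIdeal q O := by
  have key : ∀ I : Ideal (CoordRing 2 O), steinbergEqIdeal q O ⊔ Ideal.span
      {(univPhi 2 O).val.trace - ∑ i ∈ Finset.range 2, (q : CoordRing 2 O) ^ i} ≤ I ↔
      steinbergTraceEqIdeal q O ≤ I := by
    intro I
    rw [← I.mk_ker, steinbergTraceEqIdeal_le_ker_iff h1q, sup_le_iff, steinbergEqIdeal_le_ker_iff,
      span_singleton_le_ker_iff, map_sub, map_trace_univPhi, sub_eq_zero]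
    simp [Finset.sum_range_succ]
  exact le_antisymm ((key _).2 le_rfl) ((key _).1 le_rfl)

end Ideals

/-! ### Constructing points and clearing denominators -/

section Points

variable {O K : Type*} [CommRing O] [CommRing K] [Algebra O K]

theorem exists_algHom_of_isUnit_det {Φ S : Matrix (Fin 2) (Fin 2) K} (hΦ : IsUnit Φ.det)
    (hS : IsUnit S.det) : ∃ x : CoordRing 2 O →ₐ[O] K,
      phiAt (x : CoordRing 2 O →+* K) = Φ ∧ sigmaAt (x : CoordRing 2 O →+* K) = S := by
  let f : PairPoly 2 O →ₐ[O] K :=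
    MvPolynomial.aeval (Sum.elim (fun ij => Φ ij.1 ij.2) (fun ij => S ij.1 ij.2))
  have h1 : (genericFst 2 O).map f = Φ := by ext i j; simp [f, genericFst]
  have h2 : (genericSnd 2 O).map f = S := by ext i j; simp [f, genericSnd]
  have hu : IsUnit (f ((genericFst 2 O).det * (genericSnd 2 O).det)) := by
    rw [map_mul, AlgHom.map_det, AlgHom.map_det]
    exact (h1 ▸ hΦ : IsUnit ((genericFst 2 O).map f).det).mul
      (h2 ▸ hS : IsUnit ((genericSnd 2 O).map f).det)
  have hy : ∀ y : Submonoid.powers ((genericFst 2 O).det * (genericSnd 2 O).det),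
      IsUnit (f y) := by
    rintro ⟨_, k, rfl⟩
    simpa using hu.pow k
  refine ⟨IsLocalization.liftAlgHom (S := CoordRing 2 O) hy, ?_, ?_⟩
  · rw [← h1]
    ext i j
    exact IsLocalization.lift_eq (S := CoordRing 2 O) hy _
  · rw [← h2]
    ext i j
    exact IsLocalization.lift_eq (S := CoordRing 2 O) hy _

theorem exists_mul_pow_mem (x : CoordRing 2 O →ₐ[O] K) (T : Subalgebra O K)
    (hΦ : ∀ i j, phiAt (x : CoordRing 2 O →+* K) i j ∈ T)
    (hS : ∀ i j, sigmaAt (x : CoordRing 2 O →+* K) i j ∈ T) (a : CoordRing 2 O) :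
    ∃ k : ℕ, x a * ((phiAt (x : CoordRing 2 O →+* K)).det *
      (sigmaAt (x : CoordRing 2 O →+* K)).det) ^ k ∈ T := by
  obtain ⟨k, b, hb⟩ := IsLocalization.Away.surj ((genericFst 2 O).det * (genericSnd 2 O).det) a
  refine ⟨k, ?_⟩
  have h1 : x (algebraMap _ _ ((genericFst 2 O).det * (genericSnd 2 O).det)) =
      (phiAt (x : CoordRing 2 O →+* K)).det * (sigmaAt (x : CoordRing 2 O →+* K)).det := by
    rw [map_mul, map_mul, RingHom.map_det, RingHom.map_det, AlgHom.map_det, AlgHom.map_det]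
    rfl
  rw [← h1, ← map_pow, ← map_mul, hb]
  clear hb
  induction b using MvPolynomial.induction_on with
  | C r =>
    have : x (algebraMap (PairPoly 2 O) (CoordRing 2 O) (MvPolynomial.C r)) = algebraMap O K r := by
      rw [← MvPolynomial.algebraMap_eq, ← IsScalarTower.algebraMap_apply, AlgHom.commutes]
    rw [this]
    exact T.algebraMap_mem r
  | add p p' hp hp' =>
    rw [map_add, map_add]
    exact T.add_mem hp hp'
  | mul_X p v hp =>
    rw [map_mul, map_mul]
    refine T.mul_mem hp ?_
    obtain ⟨i, j⟩ | ⟨i, j⟩ := v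
    · exact hΦ i j
    · exact hS i j

end Points

/-! ### Regular unipotent matrices over a field -/

open Matrix

section Field

variable {K : Type*} [Field K]

theorem isRegularUnipotent_iff {S : Matrix (Fin 2) (Fin 2) K} :
    IsRegularUnipotent S ↔ S.trace = 2 ∧ S.det = 1 ∧ S ≠ 1 := by
  have hdeg : S.charpoly.natDegree = 2 := by rw [charpoly_natDegree_eq_dim]; simp
  constructor
  · rintro ⟨hN, hm⟩
    have ht := (isNilpotent_trace_of_isNilpotent hN).eq_zero
    have hd : (S - 1).det = 0 := by
      obtain ⟨k, hk⟩ := hN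
      have h := congrArg det hk
      rw [det_pow, det_zero] at h
      exact eq_zero_of_pow_eq_zero h
    have ht2 : S.trace = 2 := by
      rw [trace_sub, trace_one, sub_eq_zero] at ht
      simpa using ht
    refine ⟨ht2, ?_, ?_⟩
    · rw [trace_fin_two] at ht2
      rw [det_fin_two] at hd ⊢
      simp at hd
      linear_combination hd + ht2
    · rintro rfl
      rw [← hm, minpoly.one] at hdeg
      rw [← Polynomial.C_1, Polynomial.natDegree_X_sub_C] at hdeg
      omega
  · rintro ⟨ht, hd, hS⟩
    refine ⟨⟨2, by rw [sq, sub_one_mul_sub_one_eq_zero ht hd]⟩, ?_⟩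
    have hint : IsIntegral K S := Matrix.isIntegral S
    refine (Polynomial.eq_of_monic_of_dvd_of_natDegree_le (minpoly.monic hint)
      (charpoly_monic S) (minpoly_dvd_charpoly S) ?_).symm
    rw [hdeg, minpoly.two_le_natDegree_iff hint]
    rintro ⟨a, rfl⟩
    have h := congrFun (congrFun (sub_one_mul_sub_one_eq_zero ht hd) 0) 0
    simp [algebraMap_eq_diagonal, mul_apply, Fin.sum_univ_two, sub_eq_zero] at h
    rw [h, map_one] at hS
    exact hS rfl

theorem steinbergRel_of_isRegularUnipotent [CharZero K] {q : ℕ} (hq : 1 < q)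
    {Φ S : Matrix (Fin 2) (Fin 2) K} (h : Φ * S = S ^ q * Φ) (hS : IsRegularUnipotent S) :
    SteinbergRel q Φ S := by
  obtain ⟨ht, hd, hS1⟩ := isRegularUnipotent_iff.1 hS
  have htm : (Φ * (S - 1)).trace = 0 := by
    have h1 := (conj_iff ht hd).1 h
    -- Cyclicity of the trace turns `ΦN = qNΦ` into `tr(ΦN) = q tr(ΦN)`, and `q ≠ 1` in
    -- characteristic zero.
    have h2 : (Φ * (S - 1)).trace = q * (Φ * (S - 1)).trace := by
      conv_lhs => rw [h1, mul_assoc, ← nsmul_eq_mul, trace_smul, trace_mul_comm]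
      rw [nsmul_eq_mul]
    have h3 : (q : K) - 1 ≠ 0 := by
      rw [sub_ne_zero]
      exact_mod_cast hq.ne'
    refine (mul_eq_zero.1 (?_ : ((q : K) - 1) * (Φ * (S - 1)).trace = 0)).resolve_left h3
    linear_combination -h2
  refine ⟨h, ?_, ht, hd, htm⟩
  obtain ⟨e00, e01, e10, e11⟩ := conj_entries ((conj_iff ht hd).1 h)
  simp [mul_apply, Fin.sum_univ_two, trace_fin_two] at htm
  rw [trace_fin_two, det_fin_two]
  rw [trace_fin_two] at ht
  have S11 : S 1 1 = 2 - S 0 0 := by linear_combination ht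
  rw [S11] at e01 e10 e11 htm
  -- These four identities say `(1 + q) ΦN = q tr(Φ) N`. Columns of `N` are then killed by the
  -- characteristic polynomial of `Φ` evaluated at `q tr(Φ) / (1 + q)`, so `N ≠ 0` forces the
  -- relation between trace and determinant.
  have f00 : (1 + q) * (Φ 0 0 * (S 0 0 - 1) + Φ 0 1 * S 1 0) =
      q * (Φ 0 0 + Φ 1 1) * (S 0 0 - 1) := by
    linear_combination e00 + q * htm
  have f10 : (1 + q) * (Φ 1 0 * (S 0 0 - 1) + Φ 1 1 * S 1 0) =
      q * (Φ 0 0 + Φ 1 1) * S 1 0 := by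
    linear_combination e10
  have f01 : (1 + q) * (Φ 0 0 * S 0 1 - Φ 0 1 * (S 0 0 - 1)) =
      q * (Φ 0 0 + Φ 1 1) * S 0 1 := by
    linear_combination e01
  have f11 : (1 + q) * (Φ 1 0 * S 0 1 - Φ 1 1 * (S 0 0 - 1)) =
      -(q * (Φ 0 0 + Φ 1 1) * (S 0 0 - 1)) := by
    linear_combination e11 + q * htm
  rw [← sub_eq_zero]
  by_contra hne
  have g00 : S 0 0 - 1 = 0 := by
    refine (mul_eq_zero.1 ?_).resolve_left hne
    linear_combination (1 + q) * (Φ 0 0 * f00 + Φ 0 1 * f10) - (Φ 0 0 + Φ 1 1) * f00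
  have g01 : S 0 1 = 0 := by
    refine (mul_eq_zero.1 ?_).resolve_left hne
    linear_combination (1 + q) * (Φ 0 0 * f01 + Φ 0 1 * f11) - (Φ 0 0 + Φ 1 1) * f01
  have g10 : S 1 0 = 0 := by
    refine (mul_eq_zero.1 ?_).resolve_left hne
    linear_combination (1 + q) * (Φ 1 0 * f00 + Φ 1 1 * f10) - (Φ 0 0 + Φ 1 1) * f10
  apply hS1
  ext i j
  fin_cases i <;> fin_cases j <;> simp [g01, g10]
  · linear_combination g00
  · linear_combination ht - g00

end Field

/-! ### Evaluation at points of the chart -/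

section Eval

open Polynomial

variable {R K : Type*} [CommRing R] [Field K] [Algebra R K]

/-- Evaluation of functions on the chart at a point. -/
noncomputable def evalChart (w s z : K) : ChartRing R →ₐ[R] K :=
  eval₂AlgHom (MvPolynomial.aeval ![w, s]) z (fun _ => Commute.all _ _)

theorem evalChart_C (w s z : K) (p : MvPolynomial (Fin 2) R) :
    evalChart w s z (C p) = MvPolynomial.aeval ![w, s] p := eval₂_C _ _

theorem evalChart_X (w s z : K) : evalChart (R := R) w s z X = z := eval₂_X _ _

theorem evalChart_toChart (c : R) (w s z : K) (p : MvPolynomial (Fin 2 × Fin 3) R) :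
    evalChart w s z (toChart c p) =
      MvPolynomial.aeval (chart (algebraMap R K c) w s z) p := by
  rw [toChart, ← AlgHom.comp_apply, MvPolynomial.comp_aeval]
  congr 2
  funext v
  refine (map_chart _ _ _ _ (evalChart (R := R) w s z).toRingHom v).trans ?_
  simp [evalChart_C, evalChart_X]

theorem eq_zero_of_evalChart_eq_zero [Infinite K] (hinj : Function.Injective (algebraMap R K))
    {G : ChartRing R} (hG : ∀ w s z : K, s ≠ 0 → evalChart w s z G = 0) : G = 0 := by
  have h1 : ∀ w s : K, s ≠ 0 → G.map (MvPolynomial.aeval ![w, s] :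
      MvPolynomial (Fin 2) R →ₐ[R] K).toRingHom = 0 := by
    intro w s hs
    refine Polynomial.funext fun z => ?_
    rw [eval_zero, eval_map]
    exact hG w s z hs
  ext1 k
  -- Vanishing is only known for `s ≠ 0`. Multiplying by `s` makes it hold everywhere, and `s` is
  -- cancelled afterwards in a domain.
  have h2 : MvPolynomial.X 1 * MvPolynomial.map (algebraMap R K) (G.coeff k) = 0 := by
    refine MvPolynomial.funext fun v => ?_
    rw [map_mul, MvPolynomial.eval_X, map_zero]
    by_cases hv : v 1 = 0
    · rw [hv, zero_mul]
    · have h := congrArg (fun p : K[X] => p.coeff k) (h1 (v 0) (v 1) hv)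
      simp only [coeff_map, coeff_zero] at h
      have hv2 : v = ![v 0, v 1] := by ext i; fin_cases i <;> rfl
      rw [MvPolynomial.eval_map, hv2]
      refine mul_eq_zero_of_right _ ?_
      exact h
  have h3 := (mul_eq_zero.1 h2).resolve_left (MvPolynomial.X_ne_zero 1)
  rw [coeff_zero]
  exact (MvPolynomial.map_injective _ hinj) (by rw [h3, map_zero])

end Eval

/-! ### The Zariski closure -/

section Main

open Polynomial

variable {O E : Type*} [CommRing O] [Field E] [Algebra O E]

theorem mem_steinbergIdeal_iff {q : ℕ} {f : CoordRing 2 O} :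
    f ∈ steinbergIdeal 2 q O E ↔ ∀ x : CoordRing 2 O →ₐ[O] AlgebraicClosure E,
      phiAt (x : CoordRing 2 O →+* AlgebraicClosure E) * sigmaAt (x : CoordRing 2 O →+* _) =
        sigmaAt (x : CoordRing 2 O →+* _) ^ q * phiAt (x : CoordRing 2 O →+* _) →
      IsRegularUnipotent (sigmaAt (x : CoordRing 2 O →+* AlgebraicClosure E)) → x f = 0 := by
  rw [steinbergIdeal, PrimeSpectrum.vanishingIdeal_closure, PrimeSpectrum.mem_vanishingIdeal]
  constructor
  · intro h x hx hS
    exact h ⟨RingHom.ker x, RingHom.ker_isPrime _⟩ ⟨x, (map_conj_iff _ q).2 hx, hS, rfl⟩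
  · rintro h P ⟨x, hx, hS, hP⟩
    rw [hP]
    exact h x ((map_conj_iff _ q).1 hx) hS

theorem steinbergEqIdeal_le_steinbergIdeal [CharZero E] {q : ℕ} (hq : 1 < q) :
    steinbergEqIdeal q O ≤ steinbergIdeal 2 q O E := by
  intro f hf
  rw [mem_steinbergIdeal_iff]
  intro x hx hS
  have : CharZero (AlgebraicClosure E) := charZero_of_injective_algebraMap
    (algebraMap E (AlgebraicClosure E)).injective
  exact (steinbergEqIdeal_le_ker_iff (x : CoordRing 2 O →+* AlgebraicClosure E) q).2
    (steinbergRel_of_isRegularUnipotent hq hx hS) hf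

/-- The condition `s ≠ 0` gives `Σ ≠ 1`, and `t ≠ 0` with `q ≠ 0` makes `det Φ = q t²` invertible.
-/
theorem exists_steinberg_point {K : Type*} [Field K] [Algebra O K] {q : ℕ} {c : O}
    (hc : (q : O) = 2 * c + 1) (hq : (q : K) ≠ 0) {w s z t : K} (hs : s ≠ 0) (ht : t ≠ 0) :
    ∃ x : CoordRing 2 O →ₐ[O] K,
      phiAt (x : CoordRing 2 O →+* K) =
        phiOf t (algebraMap O K c + 1) (chart (algebraMap O K c) w s z) ∧
      sigmaAt (x : CoordRing 2 O →+* K) = sigmaOf (chart (algebraMap O K c) w s z) ∧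
      IsRegularUnipotent (sigmaAt (x : CoordRing 2 O →+* K)) := by
  have hr := scrollRel_chart (algebraMap O K c) w s z
  have hc' : (q : K) = 2 * algebraMap O K c + 1 := by
    have h := congrArg (algebraMap O K) hc
    simpa only [map_natCast, map_add, map_mul, map_ofNat, map_one] using h
  obtain ⟨x, h1, h2⟩ := exists_algHom_of_isUnit_det (O := O)
    (Φ := phiOf t (algebraMap O K c + 1) (chart (algebraMap O K c) w s z))
    (S := sigmaOf (chart (algebraMap O K c) w s z))
    (by rw [det_phiOf hr, ← hc']; exact (mul_ne_zero (pow_ne_zero 2 ht) hq).isUnit)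
    (by rw [det_sigmaOf hr]; exact isUnit_one)
  refine ⟨x, h1, h2, ?_⟩
  rw [h2, isRegularUnipotent_iff]
  refine ⟨trace_sigmaOf _, det_sigmaOf hr, fun h => hs ?_⟩
  simpa [sigmaOf, slMat] using congrFun (congrFun h 0) 1

end Main

open Matrix Polynomial

section Main

variable {O E : Type*} [CommRing O] [Field E] [Algebra O E]

theorem map_pairCoords {B B' : Type*} [CommRing B] [CommRing B'] (g : B →+* B') (u h : B)
    (Φ S : Matrix (Fin 2) (Fin 2) B) (v : Fin 2 × Fin 3) :
    g (pairCoords u h Φ S v) = pairCoords (g u) (g h) (Φ.map g) (S.map g) v := by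
  obtain ⟨i, j⟩ := v
  fin_cases i <;> fin_cases j <;> simp [pairCoords]

/-- The trace of `Φ` is a unit because `q tr(Φ)² = (1 + q)² det Φ` has an invertible right side. -/
theorem SteinbergRel.exists_scale {B : Type*} [CommRing B] {q : ℕ}
    {Φ S : Matrix (Fin 2) (Fin 2) B} (H : SteinbergRel q Φ S) {c : B} (hq : (q : B) = 2 * c + 1)
    (h2 : IsUnit (2 : B)) (hc : IsUnit (c + 1)) (hΦ : IsUnit Φ.det) :
    ∃ u t : B, u * t = 1 ∧ Φ.trace = 2 * (c + 1) * t := by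
  have hu : IsUnit (2 * (c + 1)) := h2.mul hc
  have h1q : (1 + q : B) = 2 * (c + 1) := by rw [hq]; ring
  have htr : IsUnit Φ.trace := by
    have h : IsUnit ((q : B) * Φ.trace ^ 2) := by
      rw [H.trace_sq, h1q]
      exact (hu.pow 2).mul hΦ
    exact (isUnit_pow_iff two_ne_zero).1 (isUnit_of_mul_isUnit_right h)
  obtain ⟨a, ha⟩ := hu.exists_left_inv
  obtain ⟨b, hb⟩ := htr.exists_left_inv
  exact ⟨2 * (c + 1) * b, a * Φ.trace, by linear_combination ha + 2 * (c + 1) * a * hb,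
    by linear_combination -Φ.trace * ha⟩

theorem eq_zero_of_forall_eval_map_eq_zero {R K : Type*} [CommRing R] [Field K] [Algebra R K]
    [Infinite K] (hinj : Function.Injective (algebraMap R K)) (c : R)
    {Y : (MvPolynomial (Fin 2 × Fin 3) R)[X]}
    (h : ∀ w s z t : K, s ≠ 0 → t ≠ 0 →
      Y.eval₂ (MvPolynomial.aeval (chart (algebraMap R K c) w s z) :
        MvPolynomial (Fin 2 × Fin 3) R →ₐ[R] K).toRingHom t = 0) (k : ℕ) :
    toChart c (Y.coeff k) = 0 := by
  refine eq_zero_of_evalChart_eq_zero hinj fun w s z hs => ?_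
  rw [evalChart_toChart]
  have h0 : Y.map (MvPolynomial.aeval (chart (algebraMap R K c) w s z) :
      MvPolynomial (Fin 2 × Fin 3) R →ₐ[R] K).toRingHom = 0 := by
    refine eq_zero_of_infinite_isRoot _
      (Set.Infinite.mono ?_ (Set.finite_singleton 0).infinite_compl)
    intro t ht
    rw [Set.mem_ofPred_eq, IsRoot, eval_map]
    exact h w s z t hs ht
  have h1 := congrArg (fun p : K[X] => p.coeff k) h0
  simp only [coeff_map, coeff_zero] at h1
  exact h1

theorem map_scale_facts (B : Type*) [CommRing B] [Algebra O B] {q : ℕ} {c : O}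
    (hc : (q : O) = 2 * c + 1) (h2 : IsUnit (2 : O)) (hc1 : IsUnit (c + 1)) :
    (q : B) = 2 * algebraMap O B c + 1 ∧ IsUnit (2 : B) ∧ IsUnit (algebraMap O B c + 1) := by
  have h := congrArg (algebraMap O B) hc
  have h2' := h2.map (algebraMap O B)
  have hc' := hc1.map (algebraMap O B)
  simp only [map_natCast, map_add, map_mul, map_ofNat, map_one] at h h2' hc'
  exact ⟨h, h2', hc'⟩

theorem steinbergIdeal_le_steinbergEqIdeal [CharZero E]
    (hinj : Function.Injective (algebraMap O E)) {q : ℕ} (hq : 1 < q) {c : O}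
    (hc : (q : O) = 2 * c + 1) (h2 : IsUnit (2 : O)) (hc1 : IsUnit (c + 1)) :
    steinbergIdeal 2 q O E ≤ steinbergEqIdeal q O := by
  intro f hf
  rw [mem_steinbergIdeal_iff] at hf
  set K := AlgebraicClosure E
  have : CharZero K := charZero_of_injective_algebraMap (algebraMap E K).injective
  have hinjK : Function.Injective (algebraMap O K) := by
    rw [IsScalarTower.algebraMap_eq O E K]
    exact (algebraMap E K).injective.comp hinj
  set B := CoordRing 2 O ⧸ steinbergEqIdeal q O
  set x : CoordRing 2 O →ₐ[O] B := Ideal.Quotient.mkₐ O _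
  have hker : RingHom.ker (x : CoordRing 2 O →+* B) = steinbergEqIdeal q O := Ideal.mk_ker
  have hrel := (steinbergEqIdeal_le_ker_iff (x : CoordRing 2 O →+* B) q).1 hker.ge
  set Φ := phiAt (x : CoordRing 2 O →+* B)
  set S := sigmaAt (x : CoordRing 2 O →+* B)
  obtain ⟨hqB, h2B, hcB⟩ := map_scale_facts B hc h2 hc1
  obtain ⟨u, t, hut, ht⟩ := hrel.exists_scale hqB h2B hcB (isUnit_det_phiAt _)
  set y := pairCoords u (algebraMap O B c + 1) Φ S
  have hy : ScrollRel (algebraMap O B c) y := hrel.scrollRel hqB h2B hcB hut ht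
  have hΦ : phiOf t (algebraMap O B c + 1) y = Φ := phiOf_pairCoords hut ht
  have hS : sigmaOf y = S := sigmaOf_pairCoords _ _ hrel.trace_snd
  -- The image of `Θ` contains the entries of `Φ` and `S`. Inverses of their determinants need not
  -- be visible there, so `f` is lifted only after multiplication by a power of the determinants.
  set Θ : (MvPolynomial (Fin 2 × Fin 3) O)[X] →ₐ[O] B :=
    eval₂AlgHom (MvPolynomial.aeval y) t (fun _ => Commute.all _ _)
  have hΘX : Θ X = t := eval₂_X _ _
  have hΘC : ∀ p, Θ (C p) = MvPolynomial.aeval y p := fun p => eval₂_C _ _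
  have hmemt : t ∈ Θ.range := ⟨X, hΘX⟩
  have hmemy : ∀ v, y v ∈ Θ.range := fun v =>
    ⟨C (MvPolynomial.X v), (hΘC _).trans (MvPolynomial.aeval_X _ _)⟩
  have hmemc : algebraMap O B c ∈ Θ.range := Θ.range.algebraMap_mem c
  have hmemΦ : ∀ i j, Φ i j ∈ Θ.range := by
    intro i j
    rw [← hΦ]
    have h1 := Θ.range.one_mem
    fin_cases i <;> fin_cases j <;> simp only [phiOf, slMat] <;> simp <;>
      refine Θ.range.mul_mem hmemt ?_
    · exact Θ.range.add_mem (hmemy _) (Θ.range.add_mem hmemc h1)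
    · exact hmemy _
    · exact hmemy _
    · exact Θ.range.add_mem (Θ.range.neg_mem (hmemy _)) (Θ.range.add_mem hmemc h1)
  have hmemS : ∀ i j, S i j ∈ Θ.range := by
    intro i j
    rw [← hS]
    have h1 := Θ.range.one_mem
    fin_cases i <;> fin_cases j <;> simp only [sigmaOf, slMat] <;> simp
    · exact Θ.range.add_mem h1 (hmemy _)
    · exact hmemy _
    · exact hmemy _
    · exact Θ.range.add_mem h1 (Θ.range.neg_mem (hmemy _))
  obtain ⟨k, Y, hY⟩ := exists_mul_pow_mem x Θ.range hmemΦ hmemS f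
  replace hY : Θ Y = _ := hY
  have hcoef : ∀ j, toChart c (Y.coeff j) = 0 := by
    refine eq_zero_of_forall_eval_map_eq_zero hinjK c fun w s z t₀ hs ht₀ => ?_
    obtain ⟨hqK, h2K, hcK⟩ := map_scale_facts K hc h2 hc1
    obtain ⟨ξ, hξΦ, hξS, hreg⟩ := exists_steinberg_point hc
      (show (q : K) ≠ 0 by exact_mod_cast (by omega : q ≠ 0)) (w := w) (z := z) hs ht₀
    have hξrel := (scrollRel_chart (algebraMap O K c) w s z).steinbergRel t₀ hqK
    rw [← hξΦ, ← hξS] at hξrel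
    have hξf := hf ξ hξrel.conj hreg
    have hξker := (steinbergEqIdeal_le_ker_iff (ξ : CoordRing 2 O →+* K) q).2 hξrel
    let η : B →ₐ[O] K := Ideal.Quotient.liftₐ _ ξ (fun a ha => hξker ha)
    have hηx : ∀ a, η (x a) = ξ a := fun a => rfl
    have hηΦ : Φ.map η = phiOf t₀ (algebraMap O K c + 1) (chart (algebraMap O K c) w s z) := hξΦ
    have hηS : S.map η = sigmaOf (chart (algebraMap O K c) w s z) := hξS
    -- The scale is recovered from `tr Φ = 2 (c + 1) t`, whose factor `2 (c + 1)` is invertible.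
    have hηt : η t = t₀ := by
      have h := congrArg η ht
      have h' : η Φ.trace = (Φ.map η).trace := by simp [trace_fin_two]
      rw [h', hηΦ, trace_phiOf] at h
      simp only [map_mul, map_add, map_ofNat, map_one, AlgHom.commutes] at h
      exact ((h2K.mul hcK).mul_left_cancel h).symm
    have hηy : ∀ v, η (y v) = chart (algebraMap O K c) w s z v := by
      intro v
      have hut' : η u * t₀ = 1 := by rw [← hηt, ← map_mul, hut, map_one]
      refine (map_pairCoords (η : B →+* K) _ _ _ _ v).trans ?_
      have h := congrFun (pairCoords_phiOf hut' (algebraMap O K c + 1)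
        (chart (algebraMap O K c) w s z)) v
      rw [← h, ← hηΦ, ← hηS]
      simp
    have hηΘ : η (Θ Y) = Y.eval₂ (MvPolynomial.aeval (chart (algebraMap O K c) w s z) :
        MvPolynomial (Fin 2 × Fin 3) O →ₐ[O] K).toRingHom t₀ := by
      refine (hom_eval₂ _ _ (η : B →+* K) _).trans ?_
      have h1 : (η : B →+* K).comp (MvPolynomial.aeval y : _ →ₐ[O] B).toRingHom =
          (MvPolynomial.aeval (chart (algebraMap O K c) w s z) :
            MvPolynomial (Fin 2 × Fin 3) O →ₐ[O] K).toRingHom := by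
        have h : η.comp (MvPolynomial.aeval y) =
            MvPolynomial.aeval (chart (algebraMap O K c) w s z) := by
          rw [MvPolynomial.comp_aeval]
          exact congrArg _ (funext hηy)
        exact congrArg AlgHom.toRingHom h
      rw [← hηt, ← h1]
      rfl
    rw [← hηΘ, hY, map_mul, hηx, hξf, zero_mul]
  have hY0 : Θ Y = 0 := by
    refine (eval₂_eq_sum_range ..).trans (Finset.sum_eq_zero fun j _ => ?_)
    exact mul_eq_zero_of_left (aeval_eq_zero_of_toChart_eq_zero hy (hcoef j)) _
  have hun := ((isUnit_det_phiAt (x : CoordRing 2 O →+* B)).mul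
    (isUnit_det_sigmaAt (x : CoordRing 2 O →+* B))).pow k
  rw [hY0] at hY
  have hxf : x f = 0 := hun.mul_left_eq_zero.1 hY.symm
  rw [← hker]
  exact hxf

end Main

open Matrix

/-! ### Units and residue characteristic of `O` -/

section Arithmetic

theorem exists_isIntegral_of_isIntegralClosure (R B : Type*) [CommRing R] [CommRing B] [Algebra R B]
    (A : Type*) [CommRing A] [Algebra A B] [IsIntegralClosure A R B] :
    ∃ _ : Algebra R A, IsScalarTower R A B ∧ Algebra.IsIntegral R A := by
  have hint : ∀ r : R, IsIntegral R (algebraMap R B r) := fun _ => isIntegral_algebraMap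
  have hinj := IsIntegralClosure.algebraMap_injective A R B
  let φ : R →+* A :=
    { toFun := fun r => IsIntegralClosure.mk' A (algebraMap R B r) (hint r)
      map_one' := hinj (by simp)
      map_mul' := fun r s => hinj (by simp)
      map_zero' := hinj (by simp)
      map_add' := fun r s => hinj (by simp) }
  let := φ.toAlgebra
  have ht : IsScalarTower R A B := IsScalarTower.of_algebraMap_eq fun r =>
    (IsIntegralClosure.algebraMap_mk' A _ (hint r)).symm
  exact ⟨inferInstance, ht, IsIntegralClosure.isIntegral_algebra R B⟩

theorem isUnit_natCast_of_coprime {l : ℕ} [Fact l.Prime] {E : Type*} [Field E] [Algebra ℤ_[l] E]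
    (O : Type*) [CommRing O] [Algebra O E] [IsIntegralClosure O ℤ_[l] E]
    {n : ℕ} (h : l.Coprime n) : IsUnit (n : O) := by
  obtain ⟨_, _, _⟩ := exists_isIntegral_of_isIntegralClosure ℤ_[l] E O
  have hu : IsUnit (n : ℤ_[l]) := PadicInt.isUnit_iff.2 (PadicInt.norm_natCast_eq_one_iff.2 h)
  simpa using hu.map (algebraMap ℤ_[l] O)

theorem natCast_prime_eq_zero_of_surjective {l : ℕ} [Fact l.Prime]
    {E : Type*} [Field E] [Algebra ℤ_[l] E]
    (O : Type*) [CommRing O] [Algebra O E] [IsIntegralClosure O ℤ_[l] E]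
    {F : Type*} [Field F] [Algebra O F]
    (hF : Function.Surjective (algebraMap O F)) : (l : F) = 0 := by
  obtain ⟨_, _, _⟩ := exists_isIntegral_of_isIntegralClosure ℤ_[l] E O
  have : (RingHom.ker (algebraMap O F)).IsMaximal := RingHom.ker_isMaximal_of_surjective _ hF
  -- A maximal ideal contracts to a maximal ideal along an integral map, and `ℤ_[l]` has only one,
  -- which contains `l`.
  have h := IsLocalRing.eq_maximalIdeal (Ideal.isMaximal_comap_of_isIntegral_of_isMaximal
    (R := ℤ_[l]) (RingHom.ker (algebraMap O F)))
  have hl : (l : ℤ_[l]) ∈ IsLocalRing.maximalIdeal ℤ_[l] := by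
    rw [PadicInt.maximalIdeal_eq_span_p]
    exact Ideal.mem_span_singleton_self _
  rw [← h] at hl
  simpa using hl

end Arithmetic

/-! ### The special fibre -/

section SpecialFibre

variable {B : Type*} [CommRing B]

/-- The ideal of the pairs `(M, N)` of commuting trace-zero matrices with
`det M = det N = tr (M N) = 0`. -/
noncomputable def nilpotentPairIdeal (F : Type*) [CommRing F] : Ideal (SlPairRing F) :=
  Ideal.span {(slPair F 0).det, (slPair F 1).det} ⊔
    matrixEqIdeal (slPair F 0 * slPair F 1) (slPair F 1 * slPair F 0) ⊔
    Ideal.span {Matrix.trace (slPair F 0 * slPair F 1)}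

theorem slPair_map {F : Type*} [CommRing F] (f : SlPairRing F →+* B) (k : Fin 2) :
    (slPair F k).map f = slMat (fun v => f (MvPolynomial.X v)) k := by
  ext i j
  fin_cases i <;> fin_cases j <;> simp [slPair, slMat]

/-- For trace-zero matrices `MN + NM = tr(MN)`, so commutation and `tr(MN) = 0` amount to `MN = NM =
0` once `2` is invertible. These are the relations with `c = 0`. -/
theorem nilpotentPairIdeal_le_ker_iff {F : Type*} [CommRing F] (h2 : IsUnit (2 : F))
    (f : SlPairRing F →+* B) :
    nilpotentPairIdeal F ≤ RingHom.ker f ↔ ScrollRel 0 (fun v => f (MvPolynomial.X v)) := by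
  have hu : IsUnit (2 : B) := by
    have h := h2.map (f.comp MvPolynomial.C)
    rwa [map_ofNat] at h
  set x : Fin 2 × Fin 3 → B := fun v => f (MvPolynomial.X v) with hx
  have hdet : ∀ k, f (slPair F k).det = (slMat x k).det := fun k => by
    rw [RingHom.map_det, RingHom.mapMatrix_apply, slPair_map]
  have hmul : ∀ i j, (slPair F i * slPair F j).map f = slMat x i * slMat x j := fun i j => by
    rw [Matrix.map_mul, slPair_map, slPair_map]
  have htr : f (slPair F 0 * slPair F 1).trace = (slMat x 0 * slMat x 1).trace := by
    rw [← hmul]; exact AddMonoidHom.map_trace f.toAddMonoidHom _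
  rw [nilpotentPairIdeal, sup_le_iff, sup_le_iff, Ideal.span_insert, sup_le_iff,
    span_singleton_le_ker_iff, span_singleton_le_ker_iff, span_singleton_le_ker_iff,
    matrixEqIdeal_le_ker_iff, hdet, hdet, hmul, hmul, htr]
  clear_value x
  constructor
  · rintro ⟨⟨⟨h0, h1⟩, hc⟩, ht⟩
    have c00 := congrFun (congrFun hc 0) 0
    have c01 := congrFun (congrFun hc 0) 1
    have c10 := congrFun (congrFun hc 1) 0
    simp [slMat, det_fin_two, trace_fin_two, mul_apply, Fin.sum_univ_two] at h0 h1 c00 c01 c10 ht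
    constructor
    · linear_combination -h0
    · linear_combination -h1
    · refine hu.mul_left_cancel ?_
      linear_combination ht - c00
    · refine hu.mul_left_cancel ?_
      linear_combination c01
    · refine hu.mul_left_cancel ?_
      linear_combination -c10
    · linear_combination c00
  · intro h
    refine ⟨⟨⟨?_, ?_⟩, ?_⟩, ?_⟩
    · simp [slMat, det_fin_two]
      linear_combination -h.sqP
    · simp [slMat, det_fin_two]
      linear_combination -h.sqN
    · ext i j
      fin_cases i <;> fin_cases j <;> simp [slMat, mul_apply, Fin.sum_univ_two]
      · linear_combination h.p1n2
      · linear_combination 2 * h.p0n1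
      · linear_combination -2 * h.p0n2
      · linear_combination -h.p1n2
    · simp [slMat, trace_fin_two]
      linear_combination 2 * h.p0n0 + h.p1n2

theorem mem_nilpotentPairIdeal_of_toChart_eq_zero {F : Type*} [CommRing F] (h2 : IsUnit (2 : F))
    {p : SlPairRing F} (hp : toChart 0 p = 0) : p ∈ nilpotentPairIdeal F := by
  have hx := (nilpotentPairIdeal_le_ker_iff h2 (Ideal.Quotient.mk (nilpotentPairIdeal F))).1
    (Ideal.mk_ker).ge
  rw [← map_zero (algebraMap F (SlPairRing F ⧸ nilpotentPairIdeal F))] at hx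
  have h := aeval_eq_zero_of_toChart_eq_zero hx hp
  rw [← Ideal.Quotient.eq_zero_iff_mem, ← h]
  have h1 := MvPolynomial.comp_aeval (R := F) MvPolynomial.X
    (Ideal.Quotient.mkₐ F (nilpotentPairIdeal F))
  rw [MvPolynomial.aeval_X_left, AlgHom.comp_id] at h1
  exact DFunLike.congr_fun h1 p

theorem natCast_eq_of_algebra {F : Type*} [CommRing F] [Algebra F B] {q : ℕ} (hqF : (q : F) = 1) :
    (q : B) = 2 * 0 + 1 := by
  rw [← map_natCast (algebraMap F B), hqF, map_one, mul_zero, zero_add]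

/-- The special fibre enters only through `hspan` (generation over `F` by the image of `x`) and
`hlift` (extension of the needed maps to the chart), so the argument is stated for any `D` with
these properties. -/
theorem exists_closedImmersion {q : ℕ} {O F D : Type*} [CommRing O] [Field F] [Algebra O F]
    [CommRing D] [Algebra F D] [Algebra O D] [IsScalarTower O F D]
    (h1q : IsUnit (1 + q : O)) (h2 : IsUnit (2 : F)) (hqF : (q : F) = 1)
    (x : CoordRing 2 O →ₐ[O] D)
    (hker : steinbergTraceEqIdeal q O ≤ RingHom.ker (x : CoordRing 2 O →+* D))
    (hspan : ∀ T : Subalgebra F D, (∀ a, x a ∈ T) → ∀ b, b ∈ T)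
    (hlift : ∀ ξ : CoordRing 2 O →ₐ[O] ChartRing F,
      steinbergTraceEqIdeal q O ≤ RingHom.ker (ξ : CoordRing 2 O →+* ChartRing F) →
      ∃ g : D →ₐ[F] ChartRing F, ∀ a, g (x a) = ξ a) :
    IsReduced D ∧ ∃ f : SlPairRing F →ₐ[F] D,
      (slPair F 0).map f = ((univPhi 2 O).val - 1).map x ∧
      (slPair F 1).map f = ((univSigma 2 O).val - 1).map x ∧
      Function.Surjective f ∧
      RingHom.ker f = nilpotentPairIdeal F := by
  obtain ⟨hrel, htr⟩ := (steinbergTraceEqIdeal_le_ker_iff h1q _).1 hker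
  set Φ := phiAt (x : CoordRing 2 O →+* D)
  set S := sigmaAt (x : CoordRing 2 O →+* D)
  have htr' : Φ.trace = 2 * (0 + 1) * 1 := by
    rw [htr, natCast_eq_of_algebra hqF]
    ring
  set y := pairCoords 1 (0 + 1) Φ S
  have hy : ScrollRel 0 y := hrel.scrollRel (natCast_eq_of_algebra hqF)
    (by have h := h2.map (algebraMap F (D)); rwa [map_ofNat] at h) (by simp) (one_mul 1) htr'
  have hΦ : phiOf 1 (0 + 1) y = Φ := phiOf_pairCoords (one_mul 1) htr'
  have hS : sigmaOf y = S := sigmaOf_pairCoords _ _ hrel.trace_snd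
  set f : SlPairRing F →ₐ[F] D := MvPolynomial.aeval y with hf
  have hfX : ∀ v, f (MvPolynomial.X v) = y v := fun v => MvPolynomial.aeval_X _ _
  have hM : ∀ k, (slPair F k).map f = slMat y k := by
    intro k
    have h := slPair_map (f : SlPairRing F →+* D) k
    simp only [RingHom.coe_coe, hfX] at h
    exact h
  have hM0 : slMat y 0 = Φ - 1 := by
    rw [← hΦ, phiOf]; simp
  have hM1 : slMat y 1 = S - 1 := by
    rw [← hS, sigmaOf]; simp
  have hle : nilpotentPairIdeal F ≤ RingHom.ker f := by
    refine (nilpotentPairIdeal_le_ker_iff h2 (f : SlPairRing F →+* D)).2 ?_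
    simp only [RingHom.coe_coe, hfX]
    exact hy
  have hsurj : Function.Surjective f := by
    have hmem : ∀ v, y v ∈ f.range := fun v => ⟨MvPolynomial.X v, hfX v⟩
    have h1 := f.range.one_mem
    have hx : ∀ a, x a ∈ f.range := by
      intro a
      obtain ⟨k, hk⟩ := exists_mul_pow_mem x (f.range.restrictScalars O)
        (by
          intro i j
          change Φ i j ∈ f.range
          have h : Φ = slMat y 0 + 1 := by rw [hM0, sub_add_cancel]
          rw [h]
          fin_cases i <;> fin_cases j <;> simp only [slMat] <;> simp
          · exact f.range.add_mem (hmem _) h1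
          · exact hmem _
          · exact hmem _
          · exact f.range.add_mem (f.range.neg_mem (hmem _)) h1)
        (by
          intro i j
          change S i j ∈ f.range
          have h : S = slMat y 1 + 1 := by rw [hM1, sub_add_cancel]
          rw [h]
          fin_cases i <;> fin_cases j <;> simp only [slMat] <;> simp
          · exact f.range.add_mem (hmem _) h1
          · exact hmem _
          · exact hmem _
          · exact f.range.add_mem (f.range.neg_mem (hmem _)) h1) a
      -- Both determinants are `1` here, so no denominators remain.
      have hd : Φ.det = 1 := by rw [← hΦ, det_phiOf hy]; ring
      change x a * (Φ.det * S.det) ^ k ∈ f.range at hk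
      rwa [hd, hrel.det_snd, one_mul, one_pow, mul_one] at hk
    exact hspan f.range hx
  have hgen : ScrollRel 0 (genericChart (0 : F)) := by
    have h := scrollRel_chart (Polynomial.C (MvPolynomial.C (0 : F)) : ChartRing F)
      (Polynomial.C (MvPolynomial.X 0)) (Polynomial.C (MvPolynomial.X 1)) Polynomial.X
    rwa [← genericChart, map_zero, map_zero] at h
  obtain ⟨ξ, hξΦ, hξS⟩ := exists_algHom_of_isUnit_det (O := O)
    (Φ := phiOf 1 (0 + 1) (genericChart (0 : F))) (S := sigmaOf (genericChart (0 : F)))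
    (by rw [det_phiOf hgen]; simp) (by rw [det_sigmaOf hgen]; exact isUnit_one)
  have hξker : steinbergTraceEqIdeal q O ≤ RingHom.ker (ξ : CoordRing 2 O →+* ChartRing F) := by
    rw [steinbergTraceEqIdeal_le_ker_iff h1q, hξΦ, hξS]
    refine ⟨hgen.steinbergRel 1 (natCast_eq_of_algebra hqF), ?_⟩
    rw [trace_phiOf, natCast_eq_of_algebra hqF]
    ring
  obtain ⟨g, hgx⟩ := hlift ξ hξker
  -- The composite `g ∘ f` is restriction to the chart, whose kernel lies in `nilpotentPairIdeal F`,
  -- which `f` kills. Hence `g` is injective, and both reducedness and the kernel of `f` follow.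
  have hgf : ∀ p, g (f p) = toChart 0 p := by
    have h : g.comp f = toChart 0 := by
      rw [hf, MvPolynomial.comp_aeval, toChart]
      congr 1
      funext v
      have h1 := congrFun (pairCoords_phiOf (one_mul 1) (0 + 1) (genericChart (0 : F))) v
      rw [← h1, ← hξΦ, ← hξS]
      refine (map_pairCoords (g : D →+* ChartRing F) _ _ _ _ v).trans ?_
      have e1 : Φ.map g = phiAt (ξ : CoordRing 2 O →+* ChartRing F) := by
        ext1 i j; exact hgx _
      have e2 : S.map g = sigmaAt (ξ : CoordRing 2 O →+* ChartRing F) := by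
        ext1 i j; exact hgx _
      simp [e1, e2]
    exact fun p => DFunLike.congr_fun h p
  have hkerf : ∀ p, toChart (0 : F) p = 0 → f p = 0 := fun p hp =>
    hle (mem_nilpotentPairIdeal_of_toChart_eq_zero h2 hp)
  have hginj : Function.Injective g := by
    rw [injective_iff_map_eq_zero]
    intro b hb
    obtain ⟨p, rfl⟩ := hsurj b
    exact hkerf p (by rw [← hgf, hb])
  refine ⟨isReduced_of_injective g hginj, f, ?_, ?_, hsurj, le_antisymm ?_ hle⟩
  · rw [hM, hM0, Matrix.map_sub _ (map_sub x), Matrix.map_one _ (map_zero x) (map_one x)]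
    rfl
  · rw [hM, hM1, Matrix.map_sub _ (map_sub x), Matrix.map_one _ (map_zero x) (map_one x)]
    rfl
  · intro p hp
    refine mem_nilpotentPairIdeal_of_toChart_eq_zero h2 ?_
    rw [← hgf, RingHom.mem_ker.1 hp, map_zero]

theorem specialFibre_closedImmersion {q : ℕ} {O E F : Type*} [CommRing O] [Field E] [Algebra O E]
    [Field F] [Algebra O F] (h1q : IsUnit (1 + q : O)) (h2 : IsUnit (2 : F)) (hqF : (q : F) = 1)
    (hI : steinbergTraceIdeal 2 q O E = steinbergTraceEqIdeal q O) :
    IsReduced (SpecialFibreRing 2 q O E F) ∧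
    ∃ f : SlPairRing F →ₐ[F] SpecialFibreRing 2 q O E F,
      (slPair F 0).map f = ((univPhi 2 O).val - 1).map (toSpecialFibre 2 q O E F) ∧
      (slPair F 1).map f = ((univSigma 2 O).val - 1).map (toSpecialFibre 2 q O E F) ∧
      Function.Surjective f ∧
      RingHom.ker f = nilpotentPairIdeal F := by
  refine exists_closedImmersion (D := SpecialFibreRing 2 q O E F) h1q h2 hqF
    (toSpecialFibre 2 q O E F) ?_ ?_ ?_
  · rw [← hI]
    intro a ha
    have h0 : Ideal.Quotient.mkₐ O (steinbergTraceIdeal 2 q O E) a = 0 :=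
      Ideal.Quotient.eq_zero_iff_mem.2 ha
    change Algebra.TensorProduct.includeRight (Ideal.Quotient.mkₐ O _ a) = 0
    rw [h0, map_zero]
  · intro T hT b
    induction b using TensorProduct.induction_on with
    | zero => exact T.zero_mem
    | add b b' hb hb' => exact T.add_mem hb hb'
    | tmul r b =>
      obtain ⟨a, rfl⟩ := Ideal.Quotient.mk_surjective b
      have h : TensorProduct.tmul O r (Ideal.Quotient.mk (steinbergTraceIdeal 2 q O E) a) =
          r • toSpecialFibre 2 q O E F a := by
        change _ = r • TensorProduct.tmul O (1 : F)
          (Ideal.Quotient.mk (steinbergTraceIdeal 2 q O E) a)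
        rw [TensorProduct.smul_tmul', smul_eq_mul, mul_one]
      rw [h]
      exact T.smul_mem (hT a) r
  · intro ξ hξ
    refine ⟨Algebra.TensorProduct.lift (Algebra.ofId F (ChartRing F))
      (Ideal.Quotient.liftₐ _ ξ fun a ha => hξ (hI ▸ ha)) (fun _ _ => Commute.all _ _),
      fun a => ?_⟩
    refine (Algebra.TensorProduct.lift_tmul _ _ _ _ _).trans ?_
    rw [map_one, one_mul]
    rfl

end SpecialFibre

end SteinbergModuli

/-! ### Arithmetic input and conclusion -/

theorem mainTheorem7 (l q : ℕ) [Fact l.Prime] (hl : 2 < l)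
    (hq : IsPrimePow q) (hql : q ≡ 1 [MOD l])
    (E : Type*) [Field E] [Algebra ℚ_[l] E] [FiniteDimensional ℚ_[l] E]
    [Algebra ℤ_[l] E] [IsScalarTower ℤ_[l] ℚ_[l] E]
    (O : Type*) [CommRing O] [Algebra O E] [IsIntegralClosure O ℤ_[l] E]
    (F : Type*) [Field F] [Algebra O F] (hF : Function.Surjective (algebraMap O F)) :
    let A := SteinbergModuli.CoordRing 2 O
    let Φ : Matrix (Fin 2) (Fin 2) A := (SteinbergModuli.univPhi 2 O).val
    let S : Matrix (Fin 2) (Fin 2) A := (SteinbergModuli.univSigma 2 O).val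
    let M := SteinbergModuli.slPair F 0
    let N := SteinbergModuli.slPair F 1
    -- equations for `X`
    (SteinbergModuli.steinbergTraceIdeal 2 q O E =
      SteinbergModuli.conjIdeal 2 q O ⊔
      SteinbergModuli.polyEqIdeal Φ.charpoly
        ((Polynomial.X - 1) * (Polynomial.X - Polynomial.C (q : A))) ⊔
      SteinbergModuli.polyEqIdeal S.charpoly ((Polynomial.X - 1) ^ 2) ⊔
      Ideal.span {Matrix.trace (Φ * (S - 1))}) ∧
    -- equations for `X_St`
    (SteinbergModuli.steinbergIdeal 2 q O E =
      SteinbergModuli.conjIdeal 2 q O ⊔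
      Ideal.span {(q : A) * Φ.trace ^ 2 - (1 + (q : A)) ^ 2 * Φ.det} ⊔
      SteinbergModuli.polyEqIdeal S.charpoly ((Polynomial.X - 1) ^ 2) ⊔
      Ideal.span {Matrix.trace (Φ * (S - 1))}) ∧
    -- the special fibre of `X` is reduced
    IsReduced (SteinbergModuli.SpecialFibreRing 2 q O E F) ∧
    -- `(Φ, Σ) ↦ (Φ - 1, Σ - 1)` is a closed immersion of the special fibre of `X` into
    -- `𝔰𝔩₂ × 𝔰𝔩₂`, with the stated equations
    ∃ f : SteinbergModuli.SlPairRing F →ₐ[F] SteinbergModuli.SpecialFibreRing 2 q O E F,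
      M.map f = (Φ - 1).map (SteinbergModuli.toSpecialFibre 2 q O E F) ∧
      N.map f = (S - 1).map (SteinbergModuli.toSpecialFibre 2 q O E F) ∧
      Function.Surjective f ∧
      RingHom.ker f =
        Ideal.span {M.det, N.det} ⊔
        SteinbergModuli.matrixEqIdeal (M * N) (N * M) ⊔
        Ideal.span {Matrix.trace (M * N)} := by
  intro A Φ S M N
  have hl' : l.Prime := Fact.out
  -- Both `2` and `1 + q` are congruent to `2` modulo `l`, with remainder exactly `2` because `l >
  -- 2`.
  have hcop : ∀ n : ℕ, n % l = 2 → IsUnit (n : O) := by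
    intro n hn
    refine SteinbergModuli.isUnit_natCast_of_coprime (l := l) (E := E) O
      ((Nat.Prime.coprime_iff_not_dvd hl').2 fun h => ?_)
    rw [Nat.mod_eq_zero_of_dvd h] at hn
    omega
  have h2 : IsUnit (2 : O) := by exact_mod_cast hcop 2 (Nat.mod_eq_of_lt hl)
  have h1q : IsUnit (1 + q : O) := by
    have h : (1 + q) % l = 2 := by
      have h := (Nat.ModEq.refl 1).add hql (n := l)
      rw [Nat.ModEq, Nat.mod_eq_of_lt hl] at h
      exact h
    exact_mod_cast hcop _ h
  have : CharZero E := charZero_of_injective_algebraMap (algebraMap ℚ_[l] E).injective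
  have hinj : Function.Injective (algebraMap O E) :=
    IsIntegralClosure.algebraMap_injective O ℤ_[l] E
  -- Here `c = (q - 1) / 2`, so that `2 (c + 1) = 1 + q`.
  obtain ⟨c, hc⟩ : ∃ c : O, (q : O) = 2 * c + 1 := by
    obtain ⟨a, ha⟩ := h2.exists_right_inv
    exact ⟨a * (q - 1), by linear_combination (1 - (q : O)) * ha⟩
  have hc1 : IsUnit (c + 1) := by
    refine isUnit_of_mul_isUnit_right (x := 2) ?_
    convert h1q using 1
    rw [hc]; ring
  have hSt : SteinbergModuli.steinbergIdeal 2 q O E = SteinbergModuli.steinbergEqIdeal q O :=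
    le_antisymm (SteinbergModuli.steinbergIdeal_le_steinbergEqIdeal hinj hq.one_lt hc h2 hc1)
      (SteinbergModuli.steinbergEqIdeal_le_steinbergIdeal hq.one_lt)
  have hX : SteinbergModuli.steinbergTraceIdeal 2 q O E =
      SteinbergModuli.steinbergTraceEqIdeal q O := by
    rw [SteinbergModuli.steinbergTraceIdeal, hSt, SteinbergModuli.steinbergTraceEqIdeal_eq h1q]
  have hlF : (l : F) = 0 := SteinbergModuli.natCast_prime_eq_zero_of_surjective (E := E) O hF
  have hqF : (q : F) = 1 := by
    obtain ⟨k, hk⟩ := (Nat.modEq_iff_dvd' hq.one_lt.le).1 hql.symm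
    have hk' : q = l * k + 1 := by have := hq.one_lt; omega
    rw [hk', Nat.cast_add, Nat.cast_mul, hlF, zero_mul, zero_add, Nat.cast_one]
  have h2F : IsUnit (2 : F) := by
    have h := h2.map (algebraMap O F)
    rwa [map_ofNat] at h
  exact ⟨hX, hSt, SteinbergModuli.specialFibre_closedImmersion h1q h2F hqF hX⟩
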